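/- Let $\mathrm{Sym}$ be the ring of symmetric functions in countably many variables $x_1,x_2,\dots$ (rational coefficients), with elementary functions $e_k$, complete functions $s_k=h_k$, and the standard scalar product $\langle\ ,\ \rangle$ (for which the $h_\lambda$ and the monomial functions $m_\mu$ are dual bases). For $f\in\mathrm{Sym}$ let $D_f$ be the Foulkes derivative, i.e. the adjoint of multiplication by $f$. For a sequence $g=(g_0=1,g_1,g_2,\dots)$ in $\mathrm{Sym}$ put $g_{i,j}=g_ig_j+2\sum_{p=1}^{j}(-1)^pg_{i+p}g_{j-p}$, and for a partition $I=(i_1\ge\dots\ge i_k\ge 0)$ with $k$ even let $\mathrm{Pf}_I(g)$ be the Pfaffian of the $k\times k$ skew-symmetric matrix with entries $g_{i_p,i_q}$ for $p<q$. Let $\widetilde Q_I=\mathrm{Pf}_I(e)$. Let $q_k$ be the coefficient of $t^k$ in $\prod_i\frac{1+x_it}{1-x_it}$, and let $P_I=2^{-\ell(I)}\,\mathrm{Pf}_I(q)$ be the Schur $P$-function, where $\ell(I)$ is the number of nonzero parts; write $P_k=P_{(k)}$. Let $Q'_I$ be the Hall--Littlewood function $Q'_I(X;t)=\prod_{i<j}\frac{1-R_{ij}}{1-tR_{ij}}\,h_I$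 at $t=-1$, where the raising operator $R_{ij}$ adds $1$ to the $i$-th and subtracts $1$ from the $j$-th component of the index of $h$, with $1\le i<j\le\ell(I)$, $h_\alpha=\prod_i h_{\alpha_i}$ and $h_m=0$ for $m<0$. Consider the following operators on $\mathrm{Sym}$; in each case the sum has only finitely many nonzero terms for every $f$: $$f\,U^s=f+\sum_{k\ge1}(-1)^k (D_{P_k}f)\,s_k,\qquad f\,U^e=f+\sum_{k\ge1}(-1)^k (D_{P_k}f)\,e_k,\qquad f\,V^e=f+\sum_{k\ge1}(-1)^k (D_{e_k}f)\,P_k .$$ Then for every strict partition $I$ (all parts different) the following identities hold in $\mathrm{Sym}$: if $\ell(I)$ is even, then $\widetilde Q_I\,U^s=\widetilde Q_I$, $Q'_I\,U^e=Q'_I$ and $P_I\,V^e=P_I$; if $\ell(I)$ is odd, then $\widetilde Q_I\,U^s=0$, $Q'_I\,U^e=0$ and $P_I\,V^e=0$. -/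

import Mathlib

noncomputable section

/-- The symmetric functions in the countably many variables `x₀, x₁, x₂, …`, with rational
coefficients: the formal power series of bounded degree that are invariant under all
permutations of the variables. -/
def symSubalgebra : Subalgebra ℚ (MvPowerSeries ℕ ℚ) where
  carrier := {f | (∀ σ : Equiv.Perm ℕ, MvPowerSeries.rename σ f = f) ∧
    ∃ N : ℕ, ∀ d : ℕ →₀ ℕ, N < d.degree → MvPowerSeries.coeff d f = 0}
  mul_mem' := by
    rintro f g ⟨hf, N, hN⟩ ⟨hg, M, hM⟩
    refine ⟨fun σ => by rw [map_mul, hf, hg], N + M, fun d hd => ?_⟩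
    classical
    rw [MvPowerSeries.coeff_mul]
    refine Finset.sum_eq_zero fun p hp => ?_
    rw [Finset.HasAntidiagonal.mem_antidiagonal] at hp
    rw [← hp, map_add] at hd
    by_cases h : N < p.1.degree
    · rw [hN _ h, zero_mul]
    · rw [hM _ (by omega), mul_zero]
  add_mem' := by
    rintro f g ⟨hf, N, hN⟩ ⟨hg, M, hM⟩
    refine ⟨fun σ => by rw [map_add, hf, hg], max N M, fun d hd => ?_⟩
    rw [map_add, hN _ (lt_of_le_of_lt (le_max_left _ _) hd),
      hM _ (lt_of_le_of_lt (le_max_right _ _) hd), add_zero]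
  algebraMap_mem' := by
    intro r
    refine ⟨fun σ => AlgHom.commutes _ _, 0, fun d hd => ?_⟩
    classical
    rw [MvPowerSeries.algebraMap_apply, MvPowerSeries.coeff_C, if_neg]
    rintro rfl
    simp at hd

/-- The ring `Sym` of symmetric functions in countably many variables. -/
def SymFun : Type := symSubalgebra

namespace SymFun

instance : CommRing SymFun := inferInstanceAs (CommRing symSubalgebra)

instance : Algebra ℚ SymFun := inferInstanceAs (Algebra ℚ symSubalgebra)

/-- The inclusion of `Sym` into the formal power series. -/
def val : SymFun →ₐ[ℚ] MvPowerSeries ℕ ℚ := symSubalgebra.val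

/-- The coefficient of the monomial `x^d`. -/
def coeff (d : ℕ →₀ ℕ) : SymFun →ₗ[ℚ] ℚ := MvPowerSeries.coeff d ∘ₗ val.toLinearMap

theorem ext_coeff {f g : SymFun} (h : ∀ d, coeff d f = coeff d g) : f = g :=
  Subtype.ext (MvPowerSeries.ext h)

theorem coeff_embDomain (f : SymFun) (σ : Equiv.Perm ℕ) (d : ℕ →₀ ℕ) :
    coeff (d.embDomain σ.toEmbedding) f = coeff d f := by
  have := MvPowerSeries.coeff_embDomain_rename σ.toEmbedding f.1 d
  have h2 : MvPowerSeries.rename σ.toEmbedding f.1 = f.1 := f.2.1 σ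
  rw [h2] at this
  exact this

theorem coeff_mul (d : ℕ →₀ ℕ) (f g : SymFun) :
    coeff d (f * g) = ∑ p ∈ Finset.HasAntidiagonal.antidiagonal d, coeff p.1 f * coeff p.2 g :=
  (MvPowerSeries.coeff_mul ..).trans (by congr)

theorem coeff_one (d : ℕ →₀ ℕ) : coeff d 1 = if d = 0 then 1 else 0 := by
  classical
  exact (MvPowerSeries.coeff_one (R := ℚ) (n := d)).trans (by congr)

/-- The symmetric function with prescribed coefficients. -/
def ofCoeff (c : (ℕ →₀ ℕ) → ℚ)
    (hc : ∀ (σ : Equiv.Perm ℕ) d, c (d.embDomain σ.toEmbedding) = c d)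
    (hb : ∃ N : ℕ, ∀ d : ℕ →₀ ℕ, N < d.degree → c d = 0) : SymFun :=
  ⟨c, by
    refine ⟨fun σ => ?_, hb⟩
    ext d
    have h : d = (d.embDomain σ.symm.toEmbedding).embDomain σ.toEmbedding := by
      rw [Finsupp.embDomain_eq_mapDomain, Finsupp.embDomain_eq_mapDomain,
        ← Finsupp.mapDomain_comp]
      simp
    rw [h]
    refine (MvPowerSeries.coeff_embDomain_rename σ.toEmbedding c _).trans ?_
    exact (hc σ _).symm⟩

@[simp] theorem coeff_ofCoeff (c hc hb) (d : ℕ →₀ ℕ) : coeff d (ofCoeff c hc hb) = c d := rfl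

theorem degree_embDomain (σ : ℕ ↪ ℕ) (d : ℕ →₀ ℕ) : (d.embDomain σ).degree = d.degree := by
  rw [Finsupp.embDomain_eq_mapDomain, Finsupp.degree_mapDomain]

/-- The complete homogeneous symmetric function `h_k = s_k`: the sum of all monomials of
degree `k`. -/
def h (k : ℕ) : SymFun :=
  ofCoeff (fun d => if d.degree = k then 1 else 0)
    (fun σ d => by simp only [degree_embDomain])
    ⟨k, fun d hd => if_neg hd.ne'⟩

open Classical in
/-- The elementary symmetric function `e_k`: the sum of all squarefree monomials of
degree `k`. -/
def e (k : ℕ) : SymFun :=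
  ofCoeff (fun d => if d.degree = k ∧ ∀ i, d i ≤ 1 then 1 else 0)
    (fun σ d => by
      have : (∀ i, (d.embDomain σ.toEmbedding) i ≤ 1) ↔ ∀ i, d i ≤ 1 := by
        rw [← σ.forall_congr_right]
        exact forall_congr' fun i => by
          rw [← Equiv.coe_toEmbedding, Finsupp.embDomain_apply_self]
      simp only [degree_embDomain, this])
    ⟨k, fun d hd => if_neg fun hk => hd.ne' hk.1⟩

theorem h_zero : h 0 = 1 := ext_coeff fun d => by
  simp [h, coeff_one, Finsupp.degree_eq_zero_iff]

open Classical in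
theorem e_zero : e 0 = 1 := ext_coeff fun d => by
  rw [coeff_one, e, coeff_ofCoeff]
  congr 1
  simp only [Finsupp.degree_eq_zero_iff, eq_iff_iff, and_iff_left_iff_imp]
  rintro rfl
  simp

theorem neg_one_pow_mul_self {R : Type*} [CommRing R] (k : ℕ) : (-1 : R) ^ k * (-1) ^ k = 1 := by
  rw [← mul_pow, neg_one_mul, neg_neg, one_pow]

theorem sum_e_h (n : ℕ) (hn : n ≠ 0) :
    ∑ p ∈ Finset.HasAntidiagonal.antidiagonal n, (-1 : SymFun) ^ p.1 * (e p.1 * h p.2) = 0 := by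
  classical
  refine ext_coeff fun d => ?_
  have key : ∀ p : ℕ × ℕ, coeff d ((-1 : SymFun) ^ p.1 * (e p.1 * h p.2)) =
      ∑ q ∈ Finset.HasAntidiagonal.antidiagonal d, (if q.1.degree = p.1 ∧ q.2.degree = p.2 then
        (if ∀ i, q.1 i ≤ 1 then (-1 : ℚ) ^ q.1.degree else 0) else 0) := by
    intro p
    have : (-1 : SymFun) ^ p.1 * (e p.1 * h p.2) = ((-1 : ℚ) ^ p.1) • (e p.1 * h p.2) := by
      rw [Algebra.smul_def]; simp
    rw [this, map_smul, coeff_mul, smul_eq_mul, Finset.mul_sum]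
    refine Finset.sum_congr rfl fun q _ => ?_
    simp only [e, h, coeff_ofCoeff]
    by_cases h1 : q.1.degree = p.1 <;> by_cases h2 : q.2.degree = p.2 <;> simp [h1, h2]
  rw [map_sum, Finset.sum_congr rfl fun p _ => key p, Finset.sum_comm, map_zero]
  by_cases hd : d.degree = n
  · have h3 : ∀ q ∈ Finset.HasAntidiagonal.antidiagonal d,
        (∑ p ∈ Finset.HasAntidiagonal.antidiagonal n, if q.1.degree = p.1 ∧ q.2.degree = p.2 then
          (if ∀ i, q.1 i ≤ 1 then (-1 : ℚ) ^ q.1.degree else 0) else 0) =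
        if ∀ i, q.1 i ≤ 1 then (-1 : ℚ) ^ q.1.degree else 0 := by
      intro q hq
      rw [Finset.HasAntidiagonal.mem_antidiagonal] at hq
      rw [Finset.sum_eq_single (q.1.degree, q.2.degree)]
      · simp
      · rintro ⟨a, b⟩ _ hne
        rw [if_neg]
        rintro ⟨rfl, rfl⟩
        exact hne rfl
      · intro hmem
        exfalso
        apply hmem
        rw [Finset.HasAntidiagonal.mem_antidiagonal, ← map_add, hq, hd]
    rw [Finset.sum_congr rfl h3, ← Finset.sum_filter]
    have hne : d.support.Nonempty := by
      rw [Finset.nonempty_iff_ne_empty, Ne, Finsupp.support_eq_empty]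
      rintro rfl
      simp at hd
      exact hn hd.symm
    have hz : ∑ S ∈ d.support.powerset, (-1 : ℚ) ^ S.card = 0 := by
      exact_mod_cast Finset.sum_powerset_neg_one_pow_card_of_nonempty hne
    rw [← hz]
    have hind : ∀ S ⊆ d.support, Finsupp.indicator S (fun _ _ => 1) ≤ d := by
      intro S hS i
      rw [Finsupp.indicator_apply]
      split_ifs with hi
      · exact Nat.one_le_iff_ne_zero.2 (Finsupp.mem_support_iff.1 (hS hi))
      · exact Nat.zero_le _
    refine Finset.sum_bij' (fun q _ => q.1.support) (fun S _ => (Finsupp.indicator S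
      (fun _ _ => 1), d - Finsupp.indicator S (fun _ _ => 1))) ?_ ?_ ?_ ?_ ?_
    · rintro q hq
      rw [Finset.mem_filter, Finset.HasAntidiagonal.mem_antidiagonal] at hq
      rw [Finset.mem_powerset]
      exact Finsupp.support_mono (hq.1 ▸ le_self_add)
    · intro S hS
      rw [Finset.mem_powerset] at hS
      rw [Finset.mem_filter, Finset.HasAntidiagonal.mem_antidiagonal]
      refine ⟨add_tsub_cancel_of_le (hind S hS), fun i => ?_⟩
      rw [Finsupp.indicator_apply]
      split_ifs <;> simp
    · rintro ⟨a, b⟩ hq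
      rw [Finset.mem_filter, Finset.HasAntidiagonal.mem_antidiagonal] at hq
      obtain ⟨hq, hs⟩ := hq
      have ha : Finsupp.indicator a.support (fun _ _ => 1) = a := by
        ext i
        have := hs i
        rw [Finsupp.indicator_apply]
        simp only [Finsupp.mem_support_iff] at *
        split_ifs with hi <;> omega
      refine Prod.ext ha ?_
      simp only [ha]
      exact (eq_tsub_of_add_eq ((add_comm _ _).trans hq)).symm
    · intro S hS
      ext i
      simp [Finsupp.indicator_apply]
    · rintro ⟨a, b⟩ hq
      rw [Finset.mem_filter] at hq
      congr 1
      rw [Finsupp.degree_apply, Finset.card_eq_sum_ones]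
      refine Finset.sum_congr rfl fun i hi => ?_
      have h1 : a i ≤ 1 := hq.2 i
      have h2 : a i ≠ 0 := Finsupp.mem_support_iff.1 hi
      change a i = 1
      omega
  · refine Finset.sum_eq_zero fun q hq => Finset.sum_eq_zero fun p hp => ?_
    rw [Finset.HasAntidiagonal.mem_antidiagonal] at hq hp
    rw [if_neg]
    rintro ⟨h1, h2⟩
    apply hd
    rw [← hq, map_add, h1, h2, hp]

/-- The polynomials with `elemPoly n (h₁, h₂, …) = e_n` and `elemPoly n (e₁, e₂, …) = h_n`. -/
def elemPoly : ℕ → MvPolynomial ℕ ℚ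
  | 0 => 1
  | n + 1 => ∑ i : Fin (n + 1), (-1) ^ (i : ℕ) * MvPolynomial.X (i : ℕ) * elemPoly (n - i)

theorem rec_e_h (n : ℕ) :
    e (n + 1) = ∑ i ∈ Finset.range (n + 1), (-1) ^ i * h (i + 1) * e (n - i) ∧
    h (n + 1) = ∑ i ∈ Finset.range (n + 1), (-1) ^ i * e (i + 1) * h (n - i) := by
  have hs := sum_e_h (n + 1) (Nat.succ_ne_zero n)
  constructor
  · rw [Finset.Nat.antidiagonal_eq_map', Finset.sum_map, Finset.sum_range_succ'] at hs
    replace hs : ∑ i ∈ Finset.range (n + 1), (-1 : SymFun) ^ (n + 1 - (i + 1)) *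
        (e (n + 1 - (i + 1)) * h (i + 1)) + (-1) ^ (n + 1) * (e (n + 1) * h 0) = 0 := hs
    rw [h_zero, mul_one] at hs
    have h2 : ((-1 : SymFun) ^ (n + 1)) * (-1) ^ (n + 1) = 1 := by
      exact neg_one_pow_mul_self _
    have h3 := congrArg (fun z => (-1 : SymFun) ^ (n + 1) * z) hs
    simp only [mul_add, ← mul_assoc, h2, one_mul, mul_zero] at h3
    rw [eq_neg_of_add_eq_zero_right h3, Finset.mul_sum, ← Finset.sum_neg_distrib]
    refine Finset.sum_congr rfl fun i hi => ?_
    rw [Finset.mem_range] at hi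
    have h4 : n + 1 - (i + 1) = n - i := by omega
    have h5 : (-1 : SymFun) ^ (n + 1) = (-1) ^ (n - i) * (-1) ^ i * (-1) := by
      rw [← pow_add, ← pow_succ]; congr 1; omega
    have h6 : ((-1 : SymFun) ^ (n - i)) * (-1) ^ (n - i) = 1 := by
      exact neg_one_pow_mul_self _
    rw [h4, h5]
    linear_combination (-1) ^ i * h (i + 1) * e (n - i) * h6
  · rw [Finset.Nat.antidiagonal_eq_map, Finset.sum_map, Finset.sum_range_succ'] at hs
    replace hs : ∑ i ∈ Finset.range (n + 1), (-1 : SymFun) ^ (i + 1) *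
        (e (i + 1) * h (n + 1 - (i + 1))) + (-1) ^ 0 * (e 0 * h (n + 1)) = 0 := hs
    rw [e_zero, pow_zero, one_mul, one_mul] at hs
    rw [eq_neg_of_add_eq_zero_right hs, ← Finset.sum_neg_distrib]
    refine Finset.sum_congr rfl fun i hi => ?_
    rw [Nat.succ_sub_succ]
    ring

/-- Substitution of `e_{k+1}` for the `k`-th variable. -/
def evalE : MvPolynomial ℕ ℚ →ₐ[ℚ] SymFun := MvPolynomial.aeval fun k => e (k + 1)

/-- Substitution of `h_{k+1}` for the `k`-th variable. -/
def evalH : MvPolynomial ℕ ℚ →ₐ[ℚ] SymFun := MvPolynomial.aeval fun k => h (k + 1)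

theorem evalE_elemPoly (n : ℕ) : evalE (elemPoly n) = h n := by
  induction n using Nat.strong_induction_on with
  | _ n ih =>
    cases n with
    | zero => rw [elemPoly, map_one, h_zero]
    | succ n =>
      rw [elemPoly, (rec_e_h n).2, map_sum, ← Fin.sum_univ_eq_sum_range
        (fun i => (-1 : SymFun) ^ i * e (i + 1) * h (n - i))]
      refine Finset.sum_congr rfl fun i _ => ?_
      rw [map_mul, map_mul, ih _ (by omega)]
      simp [evalE]

theorem evalH_elemPoly (n : ℕ) : evalH (elemPoly n) = e n := by
  induction n using Nat.strong_induction_on with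
  | _ n ih =>
    cases n with
    | zero => rw [elemPoly, map_one, e_zero]
    | succ n =>
      rw [elemPoly, (rec_e_h n).1, map_sum, ← Fin.sum_univ_eq_sum_range
        (fun i => (-1 : SymFun) ^ i * h (i + 1) * e (n - i))]
      refine Finset.sum_congr rfl fun i _ => ?_
      rw [map_mul, map_mul, ih _ (by omega)]
      simp [evalH]

theorem evalH_bijective_of (hE : Function.Bijective evalE) : Function.Bijective evalH := by
  let θ : MvPolynomial ℕ ℚ →ₐ[ℚ] MvPolynomial ℕ ℚ :=
    MvPolynomial.aeval fun k => elemPoly (k + 1)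
  have h1 : evalE.comp θ = evalH := MvPolynomial.algHom_ext fun k => by
    simp [θ, evalE_elemPoly, evalH]
  have h2 : evalH.comp θ = evalE := MvPolynomial.algHom_ext fun k => by
    simp [θ, evalH_elemPoly, evalE]
  constructor
  · intro a b hab
    have h3 : θ a = θ b := hE.1 (by
      simpa only [← h1, AlgHom.comp_apply] using hab)
    apply hE.1
    rw [← h2, AlgHom.comp_apply, AlgHom.comp_apply, h3]
  · intro f
    obtain ⟨a, rfl⟩ := hE.2 f
    exact ⟨θ a, by rw [← h2, AlgHom.comp_apply]⟩

/-- The degree of the exponent vector `a` when the `k`-th variable has degree `k + 1`. -/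
def wt (a : ℕ →₀ ℕ) : ℕ := a.sum fun k m => m * (k + 1)

theorem wt_add (a b : ℕ →₀ ℕ) : wt (a + b) = wt a + wt b :=
  Finsupp.sum_add_index' (by simp) (by intros; ring)

/-- Homogeneous symmetric functions of degree `n`. -/
def IsHomog (n : ℕ) (f : SymFun) : Prop := ∀ d, d.degree ≠ n → coeff d f = 0

theorem IsHomog.mul {m n : ℕ} {f g : SymFun} (hf : IsHomog m f) (hg : IsHomog n g) :
    IsHomog (m + n) (f * g) := by
  intro d hd
  rw [coeff_mul]
  refine Finset.sum_eq_zero fun p hp => ?_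
  rw [Finset.HasAntidiagonal.mem_antidiagonal] at hp
  rw [← hp, map_add] at hd
  by_cases h1 : p.1.degree = m
  · rw [hg p.2 (by omega), mul_zero]
  · rw [hf p.1 h1, zero_mul]

theorem isHomog_one : IsHomog 0 1 := by
  intro d hd
  rw [coeff_one, if_neg]
  rintro rfl
  simp at hd

theorem isHomog_h (n : ℕ) : IsHomog n (h n) := fun _ hd => if_neg hd

theorem isHomog_e (n : ℕ) : IsHomog n (e n) := fun _ hd => if_neg fun hk => hd hk.1

theorem isHomog_aeval {g : ℕ → SymFun} (hg : ∀ k, IsHomog (k + 1) (g k)) (a : ℕ →₀ ℕ) (c : ℚ) :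
    IsHomog (wt a) (MvPolynomial.aeval g (MvPolynomial.monomial a c)) := by
  have hp : ∀ k m, IsHomog (m * (k + 1)) (g k ^ m) := by
    intro k m
    induction m with
    | zero => simpa using isHomog_one
    | succ m ih =>
      rw [pow_succ, add_mul, one_mul]
      exact ih.mul (hg k)
  have h1 : IsHomog (wt a) (a.prod fun k m => g k ^ m) := by
    unfold wt Finsupp.sum Finsupp.prod
    induction a.support using Finset.induction_on with
    | empty => simpa using isHomog_one
    | insert k s hk ih =>
      rw [Finset.sum_insert hk, Finset.prod_insert hk]
      exact (hp _ _).mul ih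
  rw [MvPolynomial.aeval_monomial]
  intro d hd
  rw [← Algebra.smul_def, map_smul, h1 d hd, smul_zero]

/-- The part of a polynomial in which the weights of the monomials lie in `S`. -/
def restrictWt (S : Set ℕ) [DecidablePred (· ∈ S)] (a : MvPolynomial ℕ ℚ) : MvPolynomial ℕ ℚ :=
  ∑ m ∈ a.support with wt m ∈ S, MvPolynomial.monomial m (a.coeff m)

theorem wt_mem_of_mem_support {S : Set ℕ} [DecidablePred (· ∈ S)] {a : MvPolynomial ℕ ℚ}
    {m : ℕ →₀ ℕ} (hm : m ∈ (restrictWt S a).support) : wt m ∈ S := by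
  classical
  have := MvPolynomial.support_sum hm
  rw [Finset.mem_biUnion] at this
  obtain ⟨b, hb, hm⟩ := this
  have := MvPolynomial.support_monomial_subset hm
  rw [Finset.mem_singleton] at this
  rw [this]
  exact (Finset.mem_filter.1 hb).2

theorem coeff_aeval_restrictWt {g : ℕ → SymFun} (hg : ∀ k, IsHomog (k + 1) (g k)) (S : Set ℕ)
    [DecidablePred (· ∈ S)] (a : MvPolynomial ℕ ℚ) (d : ℕ →₀ ℕ) :
    coeff d (MvPolynomial.aeval g (restrictWt S a)) =
      if d.degree ∈ S then coeff d (MvPolynomial.aeval g a) else 0 := by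
  rw [restrictWt, map_sum, map_sum]
  split_ifs with hd
  · conv_rhs => rw [a.as_sum, map_sum, map_sum]
    refine Finset.sum_subset (Finset.filter_subset _ _) fun m hm hm' => ?_
    refine isHomog_aeval hg _ _ _ fun hw => hm' ?_
    rw [Finset.mem_filter]
    exact ⟨hm, hw ▸ hd⟩
  · refine Finset.sum_eq_zero fun m hm => isHomog_aeval hg _ _ _ fun hw => hd ?_
    rw [hw]
    exact (Finset.mem_filter.1 hm).2

/-- Restriction of a symmetric function to the first `n` variables. -/
def toFin (n : ℕ) : SymFun →ₐ[ℚ] MvPowerSeries (Fin n) ℚ :=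
  (MvPowerSeries.killCompl Fin.valEmbedding).comp val

theorem coeff_toFin (n : ℕ) (f : SymFun) (d : Fin n →₀ ℕ) :
    MvPowerSeries.coeff d (toFin n f) = coeff (d.embDomain Fin.valEmbedding) f :=
  MvPowerSeries.coeff_killCompl ..

theorem toFin_e (n k : ℕ) :
    toFin n (e k) = ((MvPolynomial.esymm (Fin n) ℚ k : MvPolynomial (Fin n) ℚ) :
      MvPowerSeries (Fin n) ℚ) := by
  classical
  ext d
  rw [coeff_toFin, MvPolynomial.coeff_coe, MvPolynomial.esymm_eq_sum_monomial,
    MvPolynomial.coeff_sum, e, coeff_ofCoeff]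
  simp only [MvPolynomial.coeff_monomial]
  have h1 : ∀ t : Finset (Fin n), ∑ i ∈ t, Finsupp.single i 1 =
      Finsupp.indicator t (fun _ _ => 1) := by
    intro t
    ext j
    rw [Finsupp.finsetSum_apply, Finsupp.indicator_apply]
    simp [Finsupp.single_apply]
  have h2 : (∀ i, (d.embDomain Fin.valEmbedding) i ≤ 1) ↔ ∀ i, d i ≤ 1 := by
    constructor
    · intro h i
      rw [← Finsupp.embDomain_apply_self Fin.valEmbedding d i]
      exact h _
    · intro h i
      by_cases hi : i ∈ Set.range (Fin.valEmbedding : Fin n ↪ ℕ)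
      · obtain ⟨j, rfl⟩ := hi
        rw [Finsupp.embDomain_apply_self]
        exact h j
      · rw [Finsupp.embDomain_of_notMem_range _ _ _ hi]
        exact zero_le_one
  have h3 : (d.embDomain Fin.valEmbedding).degree = d.degree := by
    rw [Finsupp.embDomain_eq_mapDomain, Finsupp.degree_mapDomain]
  rw [h2, h3]
  have h4 : (∀ i, d i ≤ 1) → d = Finsupp.indicator d.support (fun _ _ => 1) := by
    intro h
    ext i
    have := h i
    rw [Finsupp.indicator_apply]
    simp only [Finsupp.mem_support_iff]
    split_ifs with hi <;> omega
  have h5 : (∀ i, d i ≤ 1) → d.degree = d.support.card := by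
    intro h
    rw [Finsupp.degree_apply, Finset.card_eq_sum_ones]
    refine Finset.sum_congr rfl fun i hi => ?_
    have h6 := h i
    have h7 := Finsupp.mem_support_iff.1 hi
    omega
  have h6 : ∀ t : Finset (Fin n), (Finsupp.indicator t (fun _ _ => 1) : Fin n →₀ ℕ) = d →
      (∀ i, d i ≤ 1) ∧ d.support = t := by
    rintro t rfl
    refine ⟨fun i => ?_, ?_⟩
    · rw [Finsupp.indicator_apply]
      split_ifs <;> simp
    · ext i
      simp [Finsupp.indicator_apply]
  split_ifs with hd
  · rw [Finset.sum_eq_single d.support, if_pos]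
    · rw [h1, ← h4 hd.2]
    · intro t _ ht
      rw [if_neg]
      rw [h1]
      exact fun h => ht (h6 t h).2.symm
    · intro h
      exfalso
      apply h
      rw [Finset.mem_powersetCard]
      exact ⟨Finset.subset_univ _, by rw [← h5 hd.2, hd.1]⟩
  · symm
    refine Finset.sum_eq_zero fun t ht => if_neg fun h => hd ?_
    rw [h1] at h
    obtain ⟨h7, h8⟩ := h6 t h
    rw [Finset.mem_powersetCard] at ht
    exact ⟨by rw [h5 h7, h8, ht.2], h7⟩

theorem toFin_evalE (n : ℕ) (b : MvPolynomial (Fin n) ℚ) :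
    toFin n (evalE (MvPolynomial.rename Fin.val b)) =
      (((MvPolynomial.esymmAlgHom (Fin n) ℚ n b).1 : MvPolynomial (Fin n) ℚ) :
        MvPowerSeries (Fin n) ℚ) := by
  have : ((toFin n).comp evalE).comp (MvPolynomial.rename Fin.val) =
      (MvPolynomial.coeToMvPowerSeries.algHom ℚ).comp
        ((Subalgebra.val _).comp (MvPolynomial.esymmAlgHom (Fin n) ℚ n)) :=
    MvPolynomial.algHom_ext fun k => by
      simp [evalE, toFin_e, MvPolynomial.esymmAlgHom]
  simpa using DFunLike.congr_fun this b

theorem evalE_injective : Function.Injective evalE := by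
  rw [injective_iff_map_eq_zero]
  intro a ha
  obtain ⟨n, hn⟩ : ∃ n, (a.vars : Set ℕ) ⊆ Set.range (Fin.val : Fin n → ℕ) := by
    obtain ⟨n, hn⟩ := a.vars.bddAbove
    exact ⟨n + 1, fun i hi => ⟨⟨i, Nat.lt_succ_of_le (hn hi)⟩, rfl⟩⟩
  obtain ⟨b, rfl⟩ := MvPolynomial.exists_rename_eq_of_vars_subset_range a Fin.val
    Fin.val_injective hn
  have h1 := toFin_evalE n b
  rw [ha, map_zero] at h1
  have h2 : (MvPolynomial.esymmAlgHom (Fin n) ℚ n b).1 = 0 :=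
    MvPolynomial.coe_injective _ _ (by rw [← h1]; simp)
  have h3 : b = 0 := MvPolynomial.esymmAlgHom_injective (σ := Fin n) (n := n) ℚ (by simp)
    (by rw [map_zero]; exact Subtype.ext h2)
  rw [h3, map_zero]

theorem exists_perm_embDomain (N : ℕ) (d : ℕ →₀ ℕ) (hd : d.degree ≤ N) :
    ∃ (σ : Equiv.Perm ℕ) (d' : Fin N →₀ ℕ),
      d.embDomain σ.toEmbedding = d'.embDomain Fin.valEmbedding := by
  classical
  have hc : Fintype.card d.support ≤ Fintype.card (Fin N) := by
    rw [Fintype.card_coe, Fintype.card_fin]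
    refine le_trans ?_ hd
    rw [Finsupp.degree_apply, Finset.card_eq_sum_ones]
    exact Finset.sum_le_sum fun i hi => Nat.one_le_iff_ne_zero.2 (Finsupp.mem_support_iff.1 hi)
  obtain ⟨g⟩ := Function.Embedding.nonempty_of_card_le hc
  obtain ⟨σ, hσ⟩ := Equiv.Perm.exists_extending_pair (fun i : d.support => (i : ℕ))
    (fun i => (g i : ℕ)) Subtype.val_injective (Fin.val_injective.comp g.injective)
  refine ⟨σ, (d.embDomain σ.toEmbedding).comapDomain Fin.valEmbedding
    Fin.valEmbedding.injective.injOn, ?_⟩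
  rw [Finsupp.embDomain_comapDomain]
  intro j hj
  rw [Finset.mem_coe, Finsupp.support_embDomain, Finset.mem_map] at hj
  obtain ⟨i, hi, rfl⟩ := hj
  exact ⟨g ⟨i, hi⟩, (hσ ⟨i, hi⟩).symm⟩

theorem evalE_surjective : Function.Surjective evalE := by
  classical
  intro f
  obtain ⟨N, hN⟩ := f.2.2
  obtain ⟨b, hb⟩ : ∃ b, (((MvPolynomial.esymmAlgHom (Fin N) ℚ N b).1 :
      MvPolynomial (Fin N) ℚ) : MvPowerSeries (Fin N) ℚ) = toFin N f := by
    have hfin : {d : Fin N →₀ ℕ | d.degree ≤ N}.Finite := Finsupp.finite_of_degree_le N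
    let q : MvPolynomial (Fin N) ℚ := MvPowerSeries.truncFinset ℚ hfin.toFinset (toFin N f)
    have hqc : ∀ d, q.coeff d = coeff (d.embDomain Fin.valEmbedding) f := by
      intro d
      by_cases hd : d.degree ≤ N
      · rw [← coeff_toFin]
        exact MvPowerSeries.coeff_truncFinset_of_mem _ (by simpa using hd)
      · rw [show q.coeff d = 0 from
          MvPowerSeries.coeff_truncFinset_eq_zero _ (by simpa using hd)]
        refine (hN _ ?_).symm
        rw [Finsupp.embDomain_eq_mapDomain, Finsupp.degree_mapDomain]
        exact not_le.1 hd
    have hq : q.IsSymmetric := by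
      intro τ
      ext d
      have hd : d = (d.mapDomain τ.symm).mapDomain τ := by
        rw [← Finsupp.mapDomain_comp]
        simp
      rw [hd, MvPolynomial.coeff_rename_mapDomain _ τ.injective, hqc, hqc]
      obtain ⟨σ, hσ⟩ := Equiv.Perm.exists_extending_pair (fun i : Fin N => (i : ℕ))
        (fun i => (τ i : ℕ)) Fin.val_injective (Fin.val_injective.comp τ.injective)
      have : ((d.mapDomain τ.symm).mapDomain τ).embDomain (Fin.valEmbedding : Fin N ↪ ℕ) =
          ((d.mapDomain τ.symm).embDomain Fin.valEmbedding).embDomain σ.toEmbedding := by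
        simp only [Finsupp.embDomain_eq_mapDomain, ← Finsupp.mapDomain_comp]
        congr 1
        funext i
        exact (hσ _).symm
      rw [this, coeff_embDomain]
    obtain ⟨b, hb⟩ := MvPolynomial.esymmAlgHom_surjective (σ := Fin N) (n := N) ℚ (by simp) ⟨q, hq⟩
    refine ⟨b, ?_⟩
    rw [hb]
    ext d
    rw [MvPolynomial.coeff_coe, coeff_toFin]
    exact hqc d
  refine ⟨restrictWt (Set.Iic N) (MvPolynomial.rename Fin.val b), ext_coeff fun d => ?_⟩
  refine (coeff_aeval_restrictWt (fun k => isHomog_e (k + 1)) _ _ d).trans ?_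
  split_ifs with hd
  · obtain ⟨σ, d', hd'⟩ := exists_perm_embDomain N d hd
    have h1 := congrArg (MvPowerSeries.coeff d') ((toFin_evalE N b).trans hb)
    rw [coeff_toFin, coeff_toFin, ← hd', coeff_embDomain, coeff_embDomain] at h1
    exact h1
  · exact (hN d (not_le.1 hd)).symm

theorem evalH_bijective : Function.Bijective evalH :=
  evalH_bijective_of ⟨evalE_injective, evalE_surjective⟩

/-- `Sym` is the polynomial ring in `h₁, h₂, …`. -/
def hEquiv : MvPolynomial ℕ ℚ ≃ₐ[ℚ] SymFun := AlgEquiv.ofBijective evalH evalH_bijective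

theorem wt_of_mem_support_hEquiv_symm {n : ℕ} {f : SymFun} (hf : IsHomog n f) {m : ℕ →₀ ℕ}
    (hm : m ∈ (hEquiv.symm f).support) : wt m = n := by
  classical
  have h1 : hEquiv (hEquiv.symm f) = f := hEquiv.apply_symm_apply f
  have h2 : hEquiv (restrictWt {n} (hEquiv.symm f)) = f := by
    refine ext_coeff fun d => ?_
    refine (coeff_aeval_restrictWt (fun k => isHomog_h (k + 1)) _ _ d).trans ?_
    split_ifs with hd
    · exact congrArg (coeff d) h1
    · exact (hf d hd).symm
  have h3 : restrictWt {n} (hEquiv.symm f) = hEquiv.symm f :=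
    hEquiv.injective (h2.trans h1.symm)
  rw [← h3] at hm
  exact wt_mem_of_mem_support hm

/-- The exponent vector `(λ₁, λ₂, …)` of the monomial `x^λ`, for a multiset of parts. -/
def expo (s : Multiset ℕ) : ℕ →₀ ℕ := (s.sort (· ≥ ·)).toFinsupp

/-- The partition in which the part `k + 1` has multiplicity `a k`. -/
def partsOf (a : ℕ →₀ ℕ) : Multiset ℕ := (Finsupp.toMultiset a).map (· + 1)

/-- The product of the `h_{d i}`. -/
def hProd (d : ℕ →₀ ℕ) : SymFun := d.prod fun _ k => h k

theorem hEquiv_monomial (a : ℕ →₀ ℕ) :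
    hEquiv (MvPolynomial.monomial a 1) = ((partsOf a).map h).prod := by
  refine (MvPolynomial.aeval_monomial ..).trans ?_
  rw [map_one, one_mul, partsOf, Multiset.map_map]
  induction a using Finsupp.induction_linear with
  | zero => simp
  | add a b ha hb =>
    rw [Finsupp.prod_add_index' (fun _ => pow_zero _) (fun _ _ _ => pow_add _ _ _), ha, hb,
      map_add, Multiset.map_add, Multiset.prod_add]
  | single k m =>
    refine (Finsupp.prod_single_index (h := fun i m => h (i + 1) ^ m) (pow_zero _)).trans ?_
    rw [Finsupp.toMultiset_single, Multiset.map_nsmul, Multiset.prod_nsmul,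
      Multiset.map_singleton, Multiset.prod_singleton, Function.comp]

theorem hProd_expo (s : Multiset ℕ) : hProd (expo s) = (s.map h).prod := by
  conv_rhs => rw [← s.sort_eq (· ≥ ·), Multiset.map_coe, Multiset.prod_coe]
  rw [hProd, expo]
  generalize s.sort (· ≥ ·) = L
  rw [Finsupp.prod_of_support_subset _ (List.toFinsupp_support_subset L) _
    (fun _ _ => h_zero)]
  simp only [List.toFinsupp_apply]
  induction L with
  | nil => simp
  | cons x L ih =>
    rw [List.length_cons, Finset.prod_range_succ', List.map_cons, List.prod_cons, ← ih, mul_comm]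
    simp

theorem degree_expo (a : ℕ →₀ ℕ) : (expo (partsOf a)).degree = wt a := by
  have h1 : (partsOf a).sum = wt a := by
    induction a using Finsupp.induction_linear with
    | zero => simp [partsOf, wt]
    | add a b ha hb =>
      rw [wt_add, ← ha, ← hb, partsOf, map_add, Multiset.map_add, Multiset.sum_add]
      rfl
    | single k m => simp [partsOf, wt, Multiset.map_nsmul, Multiset.sum_nsmul]
  have h2 : ((partsOf a).sort (· ≥ ·)).sum = (partsOf a).sum := by
    conv_rhs => rw [← Multiset.sort_eq (partsOf a) (· ≥ ·), Multiset.sum_coe]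
  rw [← h1, ← h2, Finsupp.degree_apply, expo]
  generalize (partsOf a).sort (· ≥ ·) = L
  rw [Finset.sum_subset (List.toFinsupp_support_subset L)
    (fun i _ hi => Finsupp.notMem_support_iff.1 hi)]
  simp only [List.toFinsupp_apply]
  clear h1 h2
  induction L with
  | nil => simp
  | cons x L ih =>
    rw [List.length_cons, Finset.sum_range_succ', List.sum_cons, ← ih, add_comm]
    simp

/-- The standard scalar product on `Sym`, for which the products `h_λ` and the monomial
functions `m_μ` are dual bases: `⟨h_λ, g⟩` is the coefficient of `x^λ` in `g`. -/
def hall : SymFun →ₗ[ℚ] SymFun →ₗ[ℚ] ℚ :=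
  (MvPolynomial.basisMonomials ℕ ℚ).constr ℚ (fun a => coeff (expo (partsOf a))) ∘ₗ
    hEquiv.symm.toLinearMap

theorem hall_hEquiv_monomial (a : ℕ →₀ ℕ) (g : SymFun) :
    hall (hEquiv (MvPolynomial.monomial a 1)) g = coeff (expo (partsOf a)) g := by
  have h1 := (MvPolynomial.basisMonomials ℕ ℚ).constr_basis ℚ
    (fun a => coeff (expo (partsOf a))) a
  rw [MvPolynomial.coe_basisMonomials] at h1
  simp only [hall, LinearMap.comp_apply, AlgEquiv.toLinearMap_apply, AlgEquiv.symm_apply_apply]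
  rw [h1]

/-- The characterization of the scalar product: `⟨h_λ, g⟩` is the coefficient of `x^λ`. -/
theorem hall_h (s : Multiset ℕ) (hs : 0 ∉ s) (g : SymFun) :
    hall (s.map h).prod g = coeff (expo s) g := by
  have h1 : s = partsOf (Multiset.toFinsupp (s.map (· - 1))) := by
    rw [partsOf, Multiset.toFinsupp_toMultiset, Multiset.map_map]
    conv_lhs => rw [← Multiset.map_id s]
    refine Multiset.map_congr rfl fun x hx => ?_
    have : x ≠ 0 := fun h0 => hs (h0 ▸ hx)
    simp only [id, Function.comp]
    omega
  rw [h1, ← hEquiv_monomial, hall_hEquiv_monomial]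

theorem hall_eq_zero {f g : SymFun} {N : ℕ} (hg : ∀ d : ℕ →₀ ℕ, N < d.degree → coeff d g = 0)
    (hf : ∀ m ∈ (hEquiv.symm f).support, N < wt m) : hall f g = 0 := by
  have h1 : f = ∑ m ∈ (hEquiv.symm f).support, (hEquiv.symm f).coeff m •
      hEquiv (MvPolynomial.monomial m 1) := by
    conv_lhs => rw [← hEquiv.apply_symm_apply f, (hEquiv.symm f).as_sum, map_sum]
    refine Finset.sum_congr rfl fun m _ => ?_
    rw [← map_smul, MvPolynomial.smul_monomial, smul_eq_mul, mul_one]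
  rw [h1, map_sum, LinearMap.sum_apply]
  refine Finset.sum_eq_zero fun m hm => ?_
  rw [map_smul, LinearMap.smul_apply, hall_hEquiv_monomial, hg _ (by
    rw [degree_expo]; exact hf m hm), smul_zero]

theorem isHomog_hProd (d : ℕ →₀ ℕ) : IsHomog d.degree (hProd d) := by
  unfold hProd Finsupp.prod
  rw [Finsupp.degree_apply]
  induction d.support using Finset.induction_on with
  | empty => simpa using isHomog_one
  | insert k s hk ih =>
    rw [Finset.sum_insert hk, Finset.prod_insert hk]
    exact (isHomog_h _).mul ih

theorem le_wt_of_mem_support {f g : SymFun} {M N : ℕ}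
    (hf : ∀ m ∈ (hEquiv.symm f).support, M ≤ wt m)
    (hg : ∀ m ∈ (hEquiv.symm g).support, N ≤ wt m) :
    ∀ m ∈ (hEquiv.symm (f * g)).support, M + N ≤ wt m := by
  classical
  intro m hm
  rw [map_mul] at hm
  obtain ⟨a, ha, b, hb, rfl⟩ := Finset.mem_add.1 (MvPolynomial.support_mul _ _ hm)
  rw [wt_add]
  exact add_le_add (hf a ha) (hg b hb)

theorem exists_bound (g : SymFun) :
    ∃ N : ℕ, ∀ d : ℕ →₀ ℕ, N < d.degree → coeff d g = 0 := g.2.2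

/-- The Foulkes derivative `D_f`: the adjoint of the multiplication by `f`. The coefficient of
`x^λ` in `D_f g` is `⟨h_λ, D_f g⟩ = ⟨f h_λ, g⟩`. -/
def foulkes (f : SymFun) : SymFun →ₗ[ℚ] SymFun where
  toFun g := ofCoeff (fun d => hall (f * hProd d) g)
    (fun σ d => by rw [hProd, Finsupp.prod_embDomain, hProd])
    (by
      obtain ⟨N, hN⟩ := exists_bound g
      refine ⟨N, fun d hd => hall_eq_zero hN fun m hm => lt_of_lt_of_le hd ?_⟩
      have := le_wt_of_mem_support (M := 0) (N := d.degree) (fun _ _ => Nat.zero_le _)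
        (fun m hm => (wt_of_mem_support_hEquiv_symm (isHomog_hProd d) hm).ge) m hm
      rwa [zero_add] at this)
  map_add' g g' := ext_coeff fun d => by simp
  map_smul' c g := ext_coeff fun d => by simp

/-- `D_f` is adjoint to the multiplication by `f`. -/
theorem hall_foulkes (f g v : SymFun) : hall v (foulkes f g) = hall (f * v) g := by
  obtain ⟨p, rfl⟩ := hEquiv.surjective v
  induction p using MvPolynomial.induction_on' with
  | monomial a c =>
    have h1 : MvPolynomial.monomial a c = c • MvPolynomial.monomial a 1 := by
      rw [MvPolynomial.smul_monomial, smul_eq_mul, mul_one]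
    rw [h1, map_smul, mul_smul_comm, map_smul, map_smul, LinearMap.smul_apply,
      LinearMap.smul_apply, hall_hEquiv_monomial]
    congr 1
    change hall (f * hProd (expo (partsOf a))) g = _
    rw [hProd_expo, hEquiv_monomial]
  | add p q hp hq =>
    rw [map_add, mul_add, map_add, map_add, LinearMap.add_apply, LinearMap.add_apply, hp, hq]

theorem foulkes_eq_zero {f g : SymFun} {n N : ℕ} (hf : IsHomog n f) (hn : N < n)
    (hg : ∀ d : ℕ →₀ ℕ, N < d.degree → coeff d g = 0) : foulkes f g = 0 := by
  refine ext_coeff fun d => ?_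
  rw [map_zero]
  refine hall_eq_zero hg fun m hm => lt_of_lt_of_le hn ?_
  exact le_wt_of_mem_support (M := n) (N := 0)
    (fun m hm => (wt_of_mem_support_hEquiv_symm hf hm).ge) (fun _ _ => Nat.zero_le _) m hm

/-- For homogeneous `a k` of degree `k`, only finitely many terms of
`∑ (-1)^k (D_{a k} f) b_k` are nonzero. -/
theorem finite_support_vertex {a : ℕ → SymFun} (ha : ∀ k, IsHomog k (a k)) (b : ℕ → SymFun)
    (f : SymFun) :
    (Function.support fun k : ℕ => (-1) ^ (k + 1) * (foulkes (a (k + 1)) f * b (k + 1))).Finite := by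
  obtain ⟨N, hN⟩ := exists_bound f
  refine (Set.finite_Iic N).subset fun k hk => ?_
  by_contra hkN
  rw [Set.mem_Iic, not_le] at hkN
  apply hk
  simp only
  rw [foulkes_eq_zero (ha (k + 1)) (Nat.lt_succ_of_lt hkN) hN, zero_mul, mul_zero]

/-- Schur's `g_{i,j} = g_i g_j + 2 ∑_{p=1}^{j} (-1)^p g_{i+p} g_{j-p}`. -/
def schurPair (g : ℕ → SymFun) (i j : ℕ) : SymFun :=
  g i * g j + 2 * ∑ p ∈ Finset.Icc 1 j, (-1) ^ p * (g (i + p) * g (j - p))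

/-- The Pfaffian of the skew-symmetric matrix with the entries `M i_p i_q` for `p < q`, where
`(i_1, …, i_k)` is the given list, by expansion along the first row. -/
def pfaffian (M : ℕ → ℕ → SymFun) : List ℕ → SymFun
  | [] => 1
  | i :: L => ∑ j : Fin L.length, (-1) ^ (j : ℕ) * (M i (L.get j) * pfaffian M (L.eraseIdx j))
  termination_by L => L.length
  decreasing_by
    rw [List.length_eraseIdx_of_lt j.2, List.length_cons]
    omega

/-- A partition written with an even number of components, by adding a zero if necessary. -/
def evenList (L : List ℕ) : List ℕ := if Even L.length then L else L ++ [0]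

/-- The Pfaffian of the `g_{i_p, i_q}`, for `L = (i_1, …, i_k)` with `k` made even. -/
def schurPfaffian (g : ℕ → SymFun) (L : List ℕ) : SymFun := pfaffian (schurPair g) (evenList L)

/-- The `Q̃`-function of a partition `i_1 ≥ i_2 ≥ …`. -/
def qTilde (L : List ℕ) : SymFun := schurPfaffian e L

/-- `q_k`, the coefficient of `t^k` in `∏ (1 + x_i t) / (1 - x_i t)`. -/
def q (k : ℕ) : SymFun := ∑ p ∈ Finset.HasAntidiagonal.antidiagonal k, e p.1 * h p.2

/-- The Schur `Q`-function. -/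
def schurQ (L : List ℕ) : SymFun := schurPfaffian q L

/-- The Schur `P`-function `P_I = 2^{-ℓ(I)} Q_I`, for a list of positive parts. -/
def schurP (L : List ℕ) : SymFun := ((2 : ℚ) ^ L.length)⁻¹ • schurQ L

/-- The coefficients of `(1 - R) / (1 - t R) = 1 + ∑_{r ≥ 1} (t^r - t^{r-1}) R^r`. -/
def raisingCoeff (t : ℚ) : ℕ → ℚ
  | 0 => 1
  | r + 1 => t ^ (r + 1) - t ^ r

/-- `h_z` for an integer `z`, which is `0` for negative `z`. -/
def hInt (z : ℤ) : SymFun := if 0 ≤ z then h z.toNat else 0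

/-- The Hall–Littlewood function `Q'_I(X; t) = Q_I(X / (1 - t); t)`, that is
`∏_{i<j} (1 - R_{ij}) / (1 - t R_{ij}) h_I`, where the raising operator `R_{ij}` acts on the
index vector of `h` by adding `1` to the `i`-th and subtracting `1` from the `j`-th component.
Here `m` gives the exponents of the `R_{ij}`; the terms in which an exponent exceeds `|I|` have
an index with a negative component, hence vanish. -/
def hallLittlewoodQPrime (t : ℚ) (L : List ℕ) : SymFun :=
  ∑ m : {p : Fin L.length × Fin L.length // p.1 < p.2} → Fin (L.sum + 1),
    (∏ p, raisingCoeff t (m p)) •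
      ∏ i : Fin L.length, hInt ((L.get i : ℤ) + (∑ p, if p.1.1 = i then ((m p : ℕ) : ℤ) else 0)
        - ∑ p, if p.1.2 = i then ((m p : ℕ) : ℤ) else 0)

/-- The function `Q'_I`: the Hall–Littlewood function `Q'_I(X; t)` at `t = -1`. -/
def qPrime (L : List ℕ) : SymFun := hallLittlewoodQPrime (-1) L

theorem isHomog_q (k : ℕ) : IsHomog k (q k) := by
  intro d hd
  rw [q, map_sum]
  refine Finset.sum_eq_zero fun p hp => ((isHomog_e p.1).mul (isHomog_h p.2)) d ?_
  rwa [Finset.HasAntidiagonal.mem_antidiagonal.1 hp]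

theorem q_zero : q 0 = 1 := by simp [q, e_zero, h_zero]

theorem schurP_single (k : ℕ) : schurP [k] = (2 : ℚ)⁻¹ • q k := by
  simp [schurP, schurQ, schurPfaffian, evenList, pfaffian, schurPair, q_zero]

theorem isHomog_schurP (k : ℕ) : IsHomog k (schurP [k]) := by
  intro d hd
  rw [schurP_single, map_smul, isHomog_q k d hd, smul_zero]

/-- The vertex operator `U^s = 1 - D_{P_1} s_1 + D_{P_2} s_2 - ⋯`; operators act on their left,
so that `f` is sent to `f - (D_{P_1} f) s_1 + (D_{P_2} f) s_2 - ⋯`. -/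
def opUs (f : SymFun) : SymFun :=
  f + ∑ᶠ k : ℕ, (-1) ^ (k + 1) * (foulkes (schurP [k + 1]) f * h (k + 1))

/-- The vertex operator `U^e = 1 - D_{P_1} e_1 + D_{P_2} e_2 - ⋯`. -/
def opUe (f : SymFun) : SymFun :=
  f + ∑ᶠ k : ℕ, (-1) ^ (k + 1) * (foulkes (schurP [k + 1]) f * e (k + 1))

/-- The vertex operator `V^e = 1 - D_{e_1} P_1 + D_{e_2} P_2 - ⋯`. -/
def opVe (f : SymFun) : SymFun :=
  f + ∑ᶠ k : ℕ, (-1) ^ (k + 1) * (foulkes (e (k + 1)) f * schurP [k + 1])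

/-- The parts of a partition in weakly decreasing order. -/
def partList {n : ℕ} (I : n.Partition) : List ℕ := I.parts.sort (· ≥ ·)

end SymFun

end

/-! Put χ(f) = Σ_k (D_{a_k} f) X^k, with a = q for U^s and U^e, and a = e for V^e. By the Leibniz
rule χ is a ring homomorphism from Sym to Sym[X]. Let g be the sequence that enters the Pfaffian (e
for Q̃, h for Q', q for P), with generating function G(u). In all three cases χ takes G(u) to
G(u)(1+Xu)/(1-Xu) (`IsSpread`). This gives χ(g_{i,j}) = g_{i,j} + χ(g_i) g_j - g_i χ(g_j)
(`IsSpread.map_schurPair`), so χ changes the matrix by a skew matrix of rank at most two. Signed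
contractions ι of letters anticommute and square to zero, hence χ(Pf) = Pf + ι_{χ(g)} ι_g Pf with no
further terms (`map_pfaffian`).

Let W be χ followed by X^k ↦ (-1)^k g'_k, where G'(-u) G(u) = 1; the sequences g' are h, e, q
respectively. This substitution takes χ(g_l) to 2δ_{l,0} - g_l. Since ι_g ι_g = 0, only a letter 0
can contribute to the double contraction. A list of even length without zeros has none, so W fixes
its Pfaffian. A list of odd length is padded by one letter 0, which contributes -2 Pf, so W acts by
-1 (`IsSpread.pairing_schurPfaffian`). As P_k = q_k/2 for k ≥ 1, each of the three operators is
(1+W)/2, whence the values f and 0.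

The Leibniz rule is clear for D_{h_n}, which extracts the coefficient of x_i^n in a fresh variable
x_i. It passes to D_{e_n} because the series of the D_{e_n} is inverse to the signed series of the
D_{h_n}, and to D_{q_n} by composition.

It remains that Q'_I is the Pfaffian of the h_{i,j} (`qPrime_eq_schurPfaffian`). Splitting off the
raising operators that involve the first row shows that prepending a part i is the operator Σ_k
(-1)^k h_{i+k} D_{q_k}. The Pfaffians obey the same recursion, again by the rank-two formula
(`IsSpread.schurPfaffian_cons`). -/

open Polynomial

namespace SymFun

/-! ### Signed contractions of functions of lists -/

section Contract

variable {A : Type*} [CommRing A]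

/-- The contraction of a function of lists with a function `a` of letters:
the signed sum of `a (L_j) * f (L without its j-th letter)`. -/
def contract (a : ℕ → A) : (List ℕ → A) → List ℕ → A
  | _, [] => 0
  | f, i :: L => a i * f L - contract a (fun K => f (i :: K)) L

theorem contract_nil (a : ℕ → A) (f : List ℕ → A) : contract a f [] = 0 := rfl

theorem contract_cons (a : ℕ → A) (f : List ℕ → A) (i : ℕ) (L : List ℕ) :
    contract a f (i :: L) = a i * f L - contract a (fun K => f (i :: K)) L := rfl

theorem contract_eq_sum (a : ℕ → A) (f : List ℕ → A) (L : List ℕ) :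
    contract a f L = ∑ j : Fin L.length, (-1) ^ (j : ℕ) * (a (L.get j) * f (L.eraseIdx j)) := by
  induction L generalizing f with
  | nil => simp [contract_nil]
  | cons i L ih =>
    rw [contract_cons, ih]
    refine Eq.trans ?_ (Fin.sum_univ_succ (n := L.length) _).symm
    rw [sub_eq_add_neg, ← Finset.sum_neg_distrib]
    congr 1
    · simp
    · refine Finset.sum_congr rfl fun j _ => ?_
      simp [pow_succ]

theorem contract_congr (a : ℕ → A) {f f' : List ℕ → A} {L : List ℕ}
    (h : ∀ K : List ℕ, K.length < L.length → f K = f' K) : contract a f L = contract a f' L := by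
  rw [contract_eq_sum, contract_eq_sum]
  refine Finset.sum_congr rfl fun j _ => ?_
  rw [h]
  rw [List.length_eraseIdx_of_lt j.2]
  have := j.2
  omega

theorem contract_congr_left {a a' : ℕ → A} (f : List ℕ → A) {L : List ℕ}
    (h : ∀ i ∈ L, a i = a' i) : contract a f L = contract a' f L := by
  rw [contract_eq_sum, contract_eq_sum]
  exact Finset.sum_congr rfl fun j _ => by rw [h _ (L.get_mem j)]

theorem contract_add_left (a b : ℕ → A) (f : List ℕ → A) (L : List ℕ) :
    contract (fun i => a i + b i) f L = contract a f L + contract b f L := by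
  simp only [contract_eq_sum, add_mul, mul_add, Finset.sum_add_distrib]

theorem contract_mul_left (c : A) (a : ℕ → A) (f : List ℕ → A) (L : List ℕ) :
    contract (fun i => c * a i) f L = c * contract a f L := by
  simp only [contract_eq_sum, Finset.mul_sum]
  exact Finset.sum_congr rfl fun j _ => by ring

theorem contract_neg_left (a : ℕ → A) (f : List ℕ → A) (L : List ℕ) :
    contract (fun i => -a i) f L = -contract a f L := by
  simpa using contract_mul_left (-1) a f L

theorem contract_add_right (a : ℕ → A) (f f' : List ℕ → A) (L : List ℕ) :
    contract a (fun K => f K + f' K) L = contract a f L + contract a f' L := by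
  simp only [contract_eq_sum, mul_add, Finset.sum_add_distrib]

theorem contract_mul_right (c : A) (a : ℕ → A) (f : List ℕ → A) (L : List ℕ) :
    contract a (fun K => c * f K) L = c * contract a f L := by
  simp only [contract_eq_sum, Finset.mul_sum]
  exact Finset.sum_congr rfl fun j _ => by ring

theorem contract_neg_right (a : ℕ → A) (f : List ℕ → A) (L : List ℕ) :
    contract a (fun K => -f K) L = -contract a f L := by
  simpa using contract_mul_right (-1) a f L

theorem contract_sub_right (a : ℕ → A) (f f' : List ℕ → A) (L : List ℕ) :
    contract a (fun K => f K - f' K) L = contract a f L - contract a f' L := by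
  simp only [sub_eq_add_neg, contract_add_right, contract_neg_right]

theorem contract_zero_right (a : ℕ → A) (L : List ℕ) : contract a (fun _ => 0) L = 0 := by
  simp [contract_eq_sum]

/-- Two letters can be removed in either order, with opposite signs and the same coefficient; so the
sum cancels for every `f`, alternating or not. -/
theorem contract_self (a : ℕ → A) (f : List ℕ → A) (L : List ℕ) :
    contract a (contract a f) L = 0 := by
  induction L generalizing f with
  | nil => rfl
  | cons i L ih =>
    simp only [contract_cons, contract_sub_right, contract_mul_right, ih]
    ring

theorem contract_comm (a b : ℕ → A) (f : List ℕ → A) (L : List ℕ) :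
    contract a (contract b f) L = -contract b (contract a f) L := by
  induction L generalizing f with
  | nil => simp [contract_nil]
  | cons i L ih =>
    simp only [contract_cons, contract_sub_right, contract_mul_right, ih]
    ring

theorem contract_append_singleton (a : ℕ → A) (f : List ℕ → A) (L : List ℕ) (z : ℕ) :
    contract a f (L ++ [z]) =
      contract a (fun K => f (K ++ [z])) L + (-1) ^ L.length * (a z * f L) := by
  induction L generalizing f with
  | nil => simp [contract_cons, contract_nil]
  | cons i L ih =>
    simp only [List.cons_append, contract_cons, ih, List.length_cons, pow_succ]
    ring

theorem map_contract {B : Type*} [CommRing B] (φ : A →+* B) (a : ℕ → A) (f : List ℕ → A)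
    (L : List ℕ) : φ (contract a f L) = contract (fun i => φ (a i)) (fun K => φ (f K)) L := by
  simp only [contract_eq_sum, map_sum, map_mul, map_pow, map_neg, map_one]

end Contract

/-! ### Pfaffians and their change under a rank-two perturbation -/

theorem pfaffian_nil (M : ℕ → ℕ → SymFun) : pfaffian M [] = 1 := by rw [pfaffian]

theorem pfaffian_cons (M : ℕ → ℕ → SymFun) (i : ℕ) (L : List ℕ) :
    pfaffian M (i :: L) = contract (M i) (pfaffian M) L := by
  rw [pfaffian, contract_eq_sum]

theorem pfaffian_eq_zero (M : ℕ → ℕ → SymFun) {L : List ℕ} (hL : Odd L.length) :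
    pfaffian M L = 0 := by
  induction hn : L.length using Nat.strong_induction_on generalizing L with
  | _ n ih =>
    cases L with
    | nil => simp at hL
    | cons i L =>
      rw [pfaffian_cons, contract_eq_sum]
      refine Finset.sum_eq_zero fun j _ => ?_
      have hj := j.2
      have hl := List.length_eraseIdx_of_lt j.2
      rw [List.length_cons] at hL hn
      rw [ih _ (by omega) (by rw [hl]; grind) rfl, mul_zero, mul_zero]

/-- Padding an odd list puts the letter 0 last, so the expansion along the last column is needed as
well. It follows from the expansion along the first row because contractions anticommute. -/
theorem pfaffian_append_singleton (M : ℕ → ℕ → SymFun) (L : List ℕ) (z : ℕ) :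
    pfaffian M (L ++ [z]) = contract (fun i => M i z) (pfaffian M) L := by
  induction hn : L.length using Nat.strong_induction_on generalizing L with
  | _ n ih =>
    cases L with
    | nil => simp [pfaffian_cons, contract_nil]
    | cons i L =>
      rw [List.cons_append, pfaffian_cons, contract_append_singleton, contract_cons]
      rw [List.length_cons] at hn
      rw [contract_congr (M i) (f := fun K => pfaffian M (K ++ [z]))
        (f' := contract (fun i => M i z) (pfaffian M)) (fun K hK => ih _ (by omega) K rfl),
        contract_comm]
      simp only [pfaffian_cons]
      -- The sign matters only for odd length, where the Pfaffian is zero.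
      have : (-1 : SymFun) ^ L.length * pfaffian M L = pfaffian M L := by
        rcases Nat.even_or_odd L.length with h | h
        · rw [h.neg_one_pow, one_mul]
        · rw [pfaffian_eq_zero M h, mul_zero]
      linear_combination M i z * this

/-- If a ring homomorphism changes the entries of a skew-symmetric matrix by a matrix of the form
`a bᵀ - b aᵀ`, then it changes the Pfaffian by a double contraction. -/
theorem map_pfaffian (χ : SymFun →+* SymFun[X]) (M : ℕ → ℕ → SymFun) (a : ℕ → SymFun[X])
    (b : ℕ → SymFun) (hM : ∀ i j, χ (M i j) = C (M i j) + a i * C (b j) - C (b i) * a j)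
    (L : List ℕ) :
    χ (pfaffian M L) = C (pfaffian M L) +
      contract a (fun K => C (contract b (pfaffian M) K)) L := by
  have hC : ∀ K, C (contract b (pfaffian M) K) =
      contract (fun i => C (b i)) (fun K => C (pfaffian M K)) K := fun K => map_contract C _ _ K
  simp only [hC]
  induction hn : L.length using Nat.strong_induction_on generalizing L with
  | _ n ih =>
    cases L with
    | nil => simp [pfaffian_nil, contract_nil]
    | cons i L =>
      rw [List.length_cons] at hn
      set p : List ℕ → SymFun[X] := fun K => C (pfaffian M K) with hp
      have h1 : contract (fun i => C (b i)) (fun K => p (i :: K)) =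
          contract (fun i => C (b i)) (contract (fun j => C (M i j)) p) := by
        congr 1
        funext K
        simp only [hp, pfaffian_cons]
        exact map_contract C _ _ K
      rw [pfaffian_cons, map_contract, map_contract, contract_congr _
        (f' := fun K => p K + contract a (contract (fun i => C (b i)) p) K)
        (fun K hK => ih _ (by omega) K rfl), contract_cons]
      simp only [contract_cons, h1, hM]
      have h2 : ∀ f : List ℕ → SymFun[X],
          contract (fun j => C (M i j) + a i * C (b j) - C (b i) * a j) f L =
          contract (fun j => C (M i j)) f L + a i * contract (fun j => C (b j)) f L -
            C (b i) * contract a f L := by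
        intro f
        simp only [sub_eq_add_neg, ← neg_mul]
        rw [contract_add_left, contract_add_left, contract_mul_left, contract_mul_left]
      -- Terms with a repeated contraction by `a` or by `b` vanish. The triple contractions on the
      -- two sides differ by an even number of transpositions.
      simp only [h2, contract_add_right, contract_self, contract_sub_right, contract_mul_right]
      rw [contract_comm (fun j => C (b j)) a,
        contract_comm (fun j => C (M i j)) a]
      have h3 : contract (fun i => C (b i)) (contract (fun j => C (M i j)) p) =
          fun K => -contract (fun j => C (M i j)) (contract (fun i => C (b i)) p) K := by
        funext K
        rw [contract_comm]
      have h4 : contract (fun i => C (b i)) (contract (fun i => C (b i)) p) = fun _ => 0 :=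
        funext fun K => contract_self _ _ K
      rw [h3, h4]
      simp only [contract_neg_right, contract_zero_right]
      ring

/-! ### Foulkes derivatives as extraction of coefficients -/

/-- The scalar product is given through exponent vectors that decrease from the variable 0 on; a
permutation of the variables brings every monomial to that form. -/
theorem exists_embDomain_expo (d : ℕ →₀ ℕ) :
    ∃ (s : Multiset ℕ) (σ : Equiv.Perm ℕ), 0 ∉ s ∧ s = d.support.val.map d ∧
      d = (expo s).embDomain σ.toEmbedding := by
  classical
  set l := d.support.toList.mergeSort (fun i j => decide (d j ≤ d i)) with hl
  have hperm : l.Perm d.support.toList := List.mergeSort_perm _ _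
  have hnd : l.Nodup := hperm.nodup_iff.2 d.support.nodup_toList
  have hmem : ∀ i, i ∈ l ↔ d i ≠ 0 := fun i => by rw [hperm.mem_iff]; simp
  have hs : (d.support.val.map d).sort (· ≥ ·) = l.map d := by
    have h1 : (d.support.val.map d) = ((l.map d : List ℕ) : Multiset ℕ) := by
      rw [← Multiset.map_coe]
      congr 1
      rw [← Finset.coe_toList]
      exact (Multiset.coe_eq_coe.2 hperm).symm
    refine List.Perm.eq_of_pairwise' (r := (· ≥ ·)) (Multiset.pairwise_sort _ _) ?_ ?_
    · rw [List.pairwise_map]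
      have := List.pairwise_mergeSort (le := fun i j => decide (d j ≤ d i))
        (by intro a b c; simp; omega) (by intro a b; simp; omega) d.support.toList
      simpa using this
    · rw [← Multiset.coe_eq_coe, Multiset.sort_eq, h1]
  obtain ⟨σ, hσ⟩ := Equiv.Perm.exists_extending_pair (fun k : Fin l.length => (k : ℕ))
    (fun k => l.get k) Fin.val_injective (List.nodup_iff_injective_get.1 hnd)
  refine ⟨d.support.val.map d, σ, ?_, rfl, ?_⟩
  · rw [Multiset.mem_map]
    rintro ⟨i, hi, h0⟩
    exact Finsupp.mem_support_iff.1 hi h0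
  · ext j
    obtain ⟨k, rfl⟩ := σ.surjective j
    have := Finsupp.embDomain_apply_self σ.toEmbedding (expo (d.support.val.map d)) k
    rw [Equiv.coe_toEmbedding] at this
    rw [this, expo, hs, List.toFinsupp_apply]
    by_cases hk : k < l.length
    · rw [List.getD_eq_getElem _ _ (by simpa using hk), List.getElem_map, hσ ⟨k, hk⟩]
      rfl
    · rw [List.getD_eq_default _ _ (by simpa using hk)]
      by_contra h0
      obtain ⟨m, hm⟩ := List.get_of_mem ((hmem _).2 h0)
      rw [← hσ m] at hm
      have := σ.injective hm
      omega

theorem hall_hProd (d : ℕ →₀ ℕ) (g : SymFun) : hall (hProd d) g = coeff d g := by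
  obtain ⟨s, σ, h0, hs, hd⟩ := exists_embDomain_expo d
  have h1 : coeff d g = coeff (expo s) g := by
    conv_lhs => rw [hd]
    exact coeff_embDomain g σ _
  rw [h1, ← hall_h s h0, hs, Multiset.map_map]
  rfl

theorem coeff_foulkes (f g : SymFun) (d : ℕ →₀ ℕ) :
    coeff d (foulkes f g) = hall (f * hProd d) g := rfl

theorem foulkes_one (g : SymFun) : foulkes 1 g = g :=
  ext_coeff fun d => by rw [coeff_foulkes, one_mul, hall_hProd]

theorem foulkes_zero (g : SymFun) : foulkes 0 g = 0 :=
  ext_coeff fun d => by simp [coeff_foulkes]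

theorem foulkes_smul_left (c : ℚ) (f g : SymFun) : foulkes (c • f) g = c • foulkes f g :=
  ext_coeff fun d => by simp [coeff_foulkes]

theorem foulkes_sum_left {ι : Type*} (s : Finset ι) (f : ι → SymFun) (g : SymFun) :
    foulkes (∑ i ∈ s, f i) g = ∑ i ∈ s, foulkes (f i) g :=
  ext_coeff fun d => by simp [coeff_foulkes, Finset.sum_mul]

theorem neg_one_pow_eq_smul (k : ℕ) (f : SymFun) : (-1) ^ k * f = ((-1 : ℚ) ^ k) • f := by
  rw [Algebra.smul_def]
  simp

theorem foulkes_neg_one_pow_mul (k : ℕ) (f g : SymFun) :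
    foulkes ((-1) ^ k * f) g = (-1) ^ k * foulkes f g := by
  rw [neg_one_pow_eq_smul, foulkes_smul_left, neg_one_pow_eq_smul]

theorem foulkes_mul_left (f f' g : SymFun) : foulkes (f * f') g = foulkes f (foulkes f' g) :=
  ext_coeff fun d => by
    rw [coeff_foulkes, coeff_foulkes, hall_foulkes]
    congr 2
    ring

/-- If x_i does not occur in x^d, then multiplying the product of the h_{d_j} by h_n just gives the
variable i the exponent n. So D_{h_n} extracts the coefficient of x_i^n. -/
theorem coeff_foulkes_h (n : ℕ) {i : ℕ} {d : ℕ →₀ ℕ} (hi : d i = 0) (g : SymFun) :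
    coeff d (foulkes (h n) g) = coeff (d + Finsupp.single i n) g := by
  classical
  rw [coeff_foulkes, ← hall_hProd, hProd, hProd, Finsupp.prod_add_index_of_disjoint,
    Finsupp.prod_single_index h_zero, mul_comm]
  refine Finset.disjoint_left.2 fun j hj hj' => ?_
  have := Finsupp.support_single_subset hj'
  rw [Finset.mem_singleton] at this
  subst this
  exact Finsupp.mem_support_iff.1 hj hi

theorem exists_apply_eq_zero (d : ℕ →₀ ℕ) : ∃ i, d i = 0 := by
  obtain ⟨i, hi⟩ := Infinite.exists_notMem_finset d.support
  exact ⟨i, Finsupp.notMem_support_iff.1 hi⟩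

/-! ### Leibniz rules and the homomorphisms f ↦ Σ (D_{a_k} f) X^k -/

/-- The derivatives `D_{a_n}` satisfy the Leibniz rule of a sequence of divided powers. -/
def IsLeibniz (a : ℕ → SymFun) : Prop := ∀ n f g, foulkes (a n) (f * g) =
  ∑ p ∈ Finset.HasAntidiagonal.antidiagonal n, foulkes (a p.1) f * foulkes (a p.2) g

/-- Extracting the coefficient of x_i^n from a product is a convolution: the bijection separates the
i-th exponents of the two factors from the other ones. -/
theorem isLeibniz_h : IsLeibniz h := by
  classical
  intro n f g
  refine ext_coeff fun d => ?_
  obtain ⟨i, hi⟩ := exists_apply_eq_zero d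
  rw [coeff_foulkes_h n hi, coeff_mul, map_sum]
  simp only [coeff_mul]
  rw [← Finset.sum_product']
  refine Finset.sum_bij' (fun p _ => ((p.1 i, p.2 i), (p.1.erase i, p.2.erase i)))
    (fun q _ => (q.2.1 + Finsupp.single i q.1.1, q.2.2 + Finsupp.single i q.1.2)) ?_ ?_ ?_ ?_ ?_
  · rintro ⟨a, b⟩ hab
    rw [Finset.HasAntidiagonal.mem_antidiagonal] at hab
    have hab' : ∀ j, a j + b j = d j + Finsupp.single i n j := fun j => DFunLike.congr_fun hab j
    rw [Finset.mem_product, Finset.HasAntidiagonal.mem_antidiagonal,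
      Finset.HasAntidiagonal.mem_antidiagonal]
    constructor
    · simpa [hi] using hab' i
    · ext j
      by_cases hj : j = i
      · subst hj; simp [hi]
      · simpa [Finsupp.erase_ne hj, Finsupp.single_apply, Ne.symm hj] using hab' j
  · rintro ⟨⟨k, l⟩, ⟨a, b⟩⟩ hab
    rw [Finset.mem_product, Finset.HasAntidiagonal.mem_antidiagonal,
      Finset.HasAntidiagonal.mem_antidiagonal] at hab
    rw [Finset.HasAntidiagonal.mem_antidiagonal, ← hab.1, ← hab.2, Finsupp.single_add]
    exact add_add_add_comm ..
  · rintro ⟨a, b⟩ _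
    exact Prod.ext (Finsupp.erase_add_single i a) (Finsupp.erase_add_single i b)
  · rintro ⟨⟨k, l⟩, ⟨a, b⟩⟩ hab
    rw [Finset.mem_product, Finset.HasAntidiagonal.mem_antidiagonal,
      Finset.HasAntidiagonal.mem_antidiagonal] at hab
    have h1 : a i + b i = 0 := by rw [← hi, ← hab.2]; rfl
    have ha : a i = 0 := by omega
    have hb : b i = 0 := by omega
    have h2 : ∀ (c : ℕ →₀ ℕ) (m : ℕ), c i = 0 → (c + Finsupp.single i m).erase i = c := by
      intro c m hc
      ext j
      by_cases hj : j = i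
      · subst hj; simp [hc]
      · simp [Finsupp.erase_ne hj]
    refine Prod.ext (Prod.ext ?_ ?_) (Prod.ext (h2 _ _ ha) (h2 _ _ hb)) <;> simp [ha, hb]
  · rintro ⟨a, b⟩ _
    rw [coeff_foulkes_h (a i) (i := i) (by simp), coeff_foulkes_h (b i) (i := i) (by simp),
      Finsupp.erase_add_single, Finsupp.erase_add_single]

theorem IsLeibniz.neg_one_pow {a : ℕ → SymFun} (ha : IsLeibniz a) :
    IsLeibniz fun k => (-1) ^ k * a k := by
  intro n f g
  simp only [foulkes_neg_one_pow_mul]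
  rw [ha, Finset.mul_sum]
  refine Finset.sum_congr rfl fun p hp => ?_
  rw [← Finset.HasAntidiagonal.mem_antidiagonal.1 hp, pow_add]
  ring

theorem IsHomog.neg_one_pow {a : ℕ → SymFun} (ha : ∀ k, IsHomog k (a k)) (k : ℕ) :
    IsHomog k ((-1) ^ k * a k) := by
  intro d hd
  rw [neg_one_pow_eq_smul, map_smul, ha k d hd, smul_zero]

/-- The polynomial with the coefficients `D_{a_k} f`. -/
noncomputable def foulkesPoly (a : ℕ → SymFun) (f : SymFun) : SymFun[X] :=
  ∑ k ∈ Finset.range ((exists_bound f).choose + 1), monomial k (foulkes (a k) f)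

theorem coeff_foulkesPoly {a : ℕ → SymFun} (ha : ∀ k, IsHomog k (a k)) (f : SymFun) (n : ℕ) :
    (foulkesPoly a f).coeff n = foulkes (a n) f := by
  rw [foulkesPoly, Polynomial.finsetSum_coeff]
  simp only [Polynomial.coeff_monomial]
  rw [Finset.sum_ite_eq']
  split_ifs with hn
  · rfl
  · rw [Finset.mem_range, not_lt, Nat.succ_le_iff] at hn
    exact (foulkes_eq_zero (ha n) hn (exists_bound f).choose_spec).symm

/-- The ring homomorphism `f ↦ ∑ D_{a_k} f X^k`. -/
noncomputable def foulkesHom (a : ℕ → SymFun) (ha : ∀ k, IsHomog k (a k)) (h0 : a 0 = 1)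
    (hL : IsLeibniz a) :
    SymFun →+* SymFun[X] where
  toFun := foulkesPoly a
  map_zero' := by ext n; simp [coeff_foulkesPoly ha]
  map_one' := by
    ext n
    rw [coeff_foulkesPoly ha, Polynomial.coeff_one]
    split_ifs with hn
    · rw [hn, h0, foulkes_one]
    · refine foulkes_eq_zero (N := 0) (ha n) (Nat.pos_of_ne_zero hn) fun d hd => ?_
      rw [coeff_one, if_neg]
      rintro rfl
      simp at hd
  map_add' f g := by ext n; simp [coeff_foulkesPoly ha]
  map_mul' f g := by ext n; simp [coeff_foulkesPoly ha, hL n, Polynomial.coeff_mul]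

theorem coeff_foulkesHom {a : ℕ → SymFun} (ha h0 hL) (f : SymFun) (n : ℕ) :
    (foulkesHom a ha h0 hL f).coeff n = foulkes (a n) f := coeff_foulkesPoly ha f n

/-- The extension of a ring homomorphism `R → R[X]` to `R[X]` by `X ↦ X`. -/
noncomputable def extendPoly (ψ : SymFun →+* SymFun[X]) : SymFun[X] →+* SymFun[X] :=
  Polynomial.eval₂RingHom ψ X

theorem extendPoly_C (ψ : SymFun →+* SymFun[X]) (f : SymFun) : extendPoly ψ (C f) = ψ f := by
  simp [extendPoly]

theorem extendPoly_X (ψ : SymFun →+* SymFun[X]) : extendPoly ψ X = X := by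
  simp [extendPoly]

theorem coeff_extendPoly (ψ : SymFun →+* SymFun[X]) (p : SymFun[X]) (n : ℕ) :
    (extendPoly ψ p).coeff n =
      ∑ r ∈ Finset.HasAntidiagonal.antidiagonal n, (ψ (p.coeff r.2)).coeff r.1 := by
  induction p using Polynomial.induction_on' with
  | add p q hp hq => simp [hp, hq, Finset.sum_add_distrib]
  | monomial k c =>
    rw [← Polynomial.C_mul_X_pow_eq_monomial, map_mul, map_pow, extendPoly_C, extendPoly_X,
      Polynomial.coeff_mul_X_pow']
    simp only [Polynomial.coeff_C_mul_X_pow]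
    split_ifs with h
    · rw [Finset.sum_eq_single (n - k, k)]
      · simp
      · rintro ⟨a, b⟩ hab hne
        rw [Finset.HasAntidiagonal.mem_antidiagonal] at hab
        rw [if_neg, map_zero, Polynomial.coeff_zero]
        rintro rfl
        exact hne (Prod.ext (by simp only at hab ⊢; omega) rfl)
      · intro h1
        exact absurd (Finset.HasAntidiagonal.mem_antidiagonal.2 (by simp only; omega)) h1
    · refine (Finset.sum_eq_zero fun r hr => ?_).symm
      rw [Finset.HasAntidiagonal.mem_antidiagonal] at hr
      rw [if_neg (by omega), map_zero, Polynomial.coeff_zero]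

/-- The map is unitriangular: the n-th coefficient of the image is that of the argument plus a
contribution of its lower coefficients. -/
theorem extendPoly_injective {ψ : SymFun →+* SymFun[X]} (hψ : ∀ f, (ψ f).coeff 0 = f) :
    Function.Injective (extendPoly ψ) := by
  intro p q hpq
  ext n
  induction n using Nat.strong_induction_on with
  | _ n ih =>
    have h1 := congrArg (fun r => r.coeff n) hpq
    have h2 : ((0, n) : ℕ × ℕ) ∈ Finset.HasAntidiagonal.antidiagonal n :=
      Finset.HasAntidiagonal.mem_antidiagonal.2 (by simp)
    simp only [coeff_extendPoly] at h1
    rw [← Finset.add_sum_erase _ _ h2, ← Finset.add_sum_erase _ _ h2] at h1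
    simp only [hψ] at h1
    rw [Finset.sum_congr rfl (g := fun r : ℕ × ℕ => (ψ (q.coeff r.2)).coeff r.1)] at h1
    · exact add_right_cancel h1
    · rintro ⟨a, b⟩ hr
      rw [Finset.mem_erase, Finset.HasAntidiagonal.mem_antidiagonal] at hr
      simp only at hr ⊢
      rw [ih b]
      have : a ≠ 0 := by
        rintro rfl
        exact hr.1 (Prod.ext rfl (by simpa using hr.2))
      omega

theorem sum_h_e (n : ℕ) : ∑ p ∈ Finset.HasAntidiagonal.antidiagonal n,
    (-1 : SymFun) ^ p.1 * (h p.1 * e p.2) = if n = 0 then 1 else 0 := by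
  split_ifs with hn
  · subst hn
    simp [e_zero, h_zero]
  · have h1 := sum_e_h n hn
    rw [← Finset.Nat.sum_antidiagonal_swap] at h1
    have h2 : (-1 : SymFun) ^ n * ∑ p ∈ Finset.HasAntidiagonal.antidiagonal n,
        (-1 : SymFun) ^ p.1 * (h p.1 * e p.2) = 0 := by
      rw [← h1, Finset.mul_sum]
      refine Finset.sum_congr rfl fun p hp => ?_
      rw [← Finset.HasAntidiagonal.mem_antidiagonal.1 hp, pow_add]
      simp only [Prod.fst_swap, Prod.snd_swap]
      linear_combination (-1) ^ p.2 * (h p.1 * e p.2) * neg_one_pow_mul_self (R := SymFun) p.1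
    have h3 := congrArg (fun z => (-1 : SymFun) ^ n * z) h2
    simpa only [← mul_assoc, neg_one_pow_mul_self, one_mul, mul_zero] using h3

/-- The derivatives by the complete functions, `f ↦ ∑ D_{h_k} f X^k`. -/
noncomputable def hHom : SymFun →+* SymFun[X] := foulkesHom h isHomog_h h_zero isLeibniz_h

/-- The homomorphism `f ↦ ∑ (-1)^k D_{h_k} f X^k`. -/
noncomputable def hNegHom : SymFun →+* SymFun[X] :=
  foulkesHom (fun k => (-1) ^ k * h k) (IsHomog.neg_one_pow isHomog_h) (by simp [h_zero])
    isLeibniz_h.neg_one_pow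

theorem coeff_hHom (f : SymFun) (n : ℕ) : (hHom f).coeff n = foulkes (h n) f :=
  coeff_foulkesHom ..

theorem coeff_hNegHom (f : SymFun) (n : ℕ) : (hNegHom f).coeff n = (-1) ^ n * foulkes (h n) f :=
  (coeff_foulkesHom ..).trans (foulkes_neg_one_pow_mul ..)

theorem extendPoly_hNegHom_injective : Function.Injective (extendPoly hNegHom) :=
  extendPoly_injective fun f => by rw [coeff_hNegHom, h_zero, foulkes_one, pow_zero, one_mul]

/-- Derivatives compose as their indices multiply, so the relation Σ (-1)^i h_i e_j = 0 in positive
degree makes the signed h-series undo the e-series. -/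
theorem extendPoly_hNegHom_foulkesPoly (f : SymFun) :
    extendPoly hNegHom (foulkesPoly e f) = C f := by
  ext n
  rw [coeff_extendPoly]
  simp only [coeff_hNegHom, coeff_foulkesPoly isHomog_e, ← foulkes_mul_left,
    ← foulkes_neg_one_pow_mul]
  rw [← foulkes_sum_left, sum_h_e, Polynomial.coeff_C]
  split_ifs
  · exact foulkes_one f
  · exact foulkes_zero f

/-- An injective ring homomorphism takes the e-series of `f` to the constant `C f`; since constants
multiply, so do the e-series. -/
theorem isLeibniz_e : IsLeibniz e := by
  intro n f g
  have h1 : foulkesPoly e (f * g) = foulkesPoly e f * foulkesPoly e g :=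
    extendPoly_hNegHom_injective (by
      rw [map_mul, extendPoly_hNegHom_foulkesPoly, extendPoly_hNegHom_foulkesPoly,
        extendPoly_hNegHom_foulkesPoly, map_mul])
  rw [← coeff_foulkesPoly isHomog_e, h1, Polynomial.coeff_mul]
  simp only [coeff_foulkesPoly isHomog_e]

/-- The derivatives by the elementary functions, `f ↦ ∑ D_{e_k} f X^k`. -/
noncomputable def eHom : SymFun →+* SymFun[X] := foulkesHom e isHomog_e e_zero isLeibniz_e

theorem coeff_eHom (f : SymFun) (n : ℕ) : (eHom f).coeff n = foulkes (e n) f :=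
  coeff_foulkesHom ..

theorem extendPoly_hNegHom_eHom (f : SymFun) : extendPoly hNegHom (eHom f) = C f :=
  extendPoly_hNegHom_foulkesPoly f

/-- The derivatives by the functions `q_k`, `f ↦ ∑ D_{q_k} f X^k`. -/
noncomputable def qHom : SymFun →+* SymFun[X] := (extendPoly eHom).comp hHom

theorem coeff_qHom (f : SymFun) (n : ℕ) : (qHom f).coeff n = foulkes (q n) f := by
  rw [qHom, RingHom.comp_apply, coeff_extendPoly, q, foulkes_sum_left]
  exact Finset.sum_congr rfl fun p _ => by rw [coeff_hHom, coeff_eHom, foulkes_mul_left]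

/-! ### Action of the homomorphisms on e, h and q -/

theorem foulkes_h_h (n m : ℕ) : foulkes (h n) (h (m + n)) = h m := by
  refine ext_coeff fun d => ?_
  obtain ⟨i, hi⟩ := exists_apply_eq_zero d
  rw [coeff_foulkes_h n hi]
  simp [h]

theorem foulkes_h_h_of_lt {n m : ℕ} (hm : m < n) : foulkes (h n) (h m) = 0 :=
  foulkes_eq_zero (isHomog_h n) hm fun _ hd => isHomog_h m _ hd.ne'

theorem foulkes_h_one_e (m : ℕ) : foulkes (h 1) (e (m + 1)) = e m := by
  classical
  refine ext_coeff fun d => ?_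
  obtain ⟨i, hi⟩ := exists_apply_eq_zero d
  rw [coeff_foulkes_h 1 hi, e, e, coeff_ofCoeff, coeff_ofCoeff]
  congr 1
  rw [map_add, Finsupp.degree_single, add_left_inj, eq_iff_iff]
  refine and_congr_right fun _ => forall_congr' fun j => ?_
  by_cases hj : j = i
  · subst hj; simp [hi]
  · simp [hj]

theorem foulkes_h_add_two_e (n m : ℕ) : foulkes (h (n + 2)) (e m) = 0 := by
  classical
  refine ext_coeff fun d => ?_
  obtain ⟨i, hi⟩ := exists_apply_eq_zero d
  rw [coeff_foulkes_h _ hi, e, coeff_ofCoeff, if_neg, map_zero]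
  rintro ⟨-, h1⟩
  have := h1 i
  simp [hi] at this

/-- With H(u) and E(u) the generating functions, `hHom` takes H(u) to H(u)/(1-Xu) and E(u) to
E(u)(1+Xu), while `eHom` interchanges the two factors. These rules are used as recursions for the
coefficients, which avoids division. -/
theorem hHom_h_succ (n : ℕ) : hHom (h (n + 1)) = C (h (n + 1)) + X * hHom (h n) := by
  ext k
  cases k with
  | zero => simp [coeff_hHom, h_zero, foulkes_one]
  | succ k =>
    rw [Polynomial.coeff_add, Polynomial.coeff_X_mul, coeff_hHom, coeff_hHom, Polynomial.coeff_C,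
      if_neg k.succ_ne_zero, zero_add]
    rcases le_or_gt k n with hk | hk
    · obtain ⟨m, rfl⟩ := Nat.exists_eq_add_of_le' hk
      rw [foulkes_h_h, add_assoc, foulkes_h_h]
    · rw [foulkes_h_h_of_lt hk, foulkes_h_h_of_lt (by omega)]

theorem hHom_e_succ (n : ℕ) : hHom (e (n + 1)) = C (e (n + 1)) + X * C (e n) := by
  ext k
  rw [Polynomial.coeff_add, coeff_hHom]
  match k with
  | 0 => simp [h_zero, foulkes_one]
  | 1 => simp [foulkes_h_one_e, Polynomial.coeff_C]
  | k + 2 => simp [foulkes_h_add_two_e]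

theorem hNegHom_eq (f : SymFun) : hNegHom f = (hHom f).comp (-X) := by
  ext n
  have h1 : (-X : SymFun[X]) = C (-1) * X := by simp
  rw [coeff_hNegHom, ← coeff_hHom, h1, Polynomial.comp_C_mul_X_coeff, mul_comm]

theorem hNegHom_h_succ (n : ℕ) : hNegHom (h (n + 1)) = C (h (n + 1)) - X * hNegHom (h n) := by
  rw [hNegHom_eq, hNegHom_eq, hHom_h_succ]
  simp [sub_eq_add_neg]

theorem hNegHom_e_succ (n : ℕ) : hNegHom (e (n + 1)) = C (e (n + 1)) - X * C (e n) := by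
  rw [hNegHom_eq, hHom_e_succ]
  simp [sub_eq_add_neg]

theorem eHom_h_succ (n : ℕ) : eHom (h (n + 1)) = C (h (n + 1)) + X * C (h n) :=
  extendPoly_hNegHom_injective (by
    rw [extendPoly_hNegHom_eHom, map_add, map_mul, extendPoly_C, extendPoly_C, extendPoly_X,
      hNegHom_h_succ]
    ring)

theorem eHom_e_succ (n : ℕ) : eHom (e (n + 1)) = C (e (n + 1)) + X * eHom (e n) :=
  extendPoly_hNegHom_injective (by
    rw [extendPoly_hNegHom_eHom, map_add, map_mul, extendPoly_C, extendPoly_hNegHom_eHom,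
      extendPoly_X, hNegHom_e_succ]
    ring)

/-- The sequence `g` with generating function `G(u)` is transformed by `χ` into
`G(u) (1 + X u) / (1 - X u)`. -/
structure IsSpread (χ : SymFun →+* SymFun[X]) (g : ℕ → SymFun) : Prop where
  zero : g 0 = 1
  succ : ∀ n, χ (g (n + 1)) = X * χ (g n) + C (g (n + 1)) + X * C (g n)

theorem isSpread_qHom_h : IsSpread qHom h where
  zero := h_zero
  succ n := by
    rw [qHom, RingHom.comp_apply, RingHom.comp_apply, hHom_h_succ, map_add, map_mul, extendPoly_C,
      extendPoly_X, eHom_h_succ]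
    ring

theorem isSpread_qHom_e : IsSpread qHom e where
  zero := e_zero
  succ n := by
    have h1 : ∀ n, qHom (e (n + 1)) = eHom (e (n + 1)) + X * eHom (e n) := fun n => by
      rw [qHom, RingHom.comp_apply, hHom_e_succ, map_add, map_mul, extendPoly_C, extendPoly_C,
        extendPoly_X]
    rw [h1, eHom_e_succ]
    -- `h1` reaches positive indices only, but `qHom (e n)` occurs on the right.
    cases n with
    | zero => rw [e_zero, map_one, map_one, map_one]; ring
    | succ n => rw [h1, eHom_e_succ]; ring

theorem isSpread_eHom_q : IsSpread eHom q where
  zero := q_zero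
  succ n := by
    have hq : (PowerSeries.mk q) = PowerSeries.mk e * PowerSeries.mk h := by
      ext n
      rw [PowerSeries.coeff_mul, PowerSeries.coeff_mk, q]
      simp only [PowerSeries.coeff_mk]
    have h0 : ∀ (χ : SymFun →+* SymFun[X]) (g : ℕ → SymFun), g 0 = 1 →
        PowerSeries.constantCoeff (PowerSeries.map χ (PowerSeries.mk g)) = 1 := by
      intro χ g hg
      rw [← PowerSeries.coeff_zero_eq_constantCoeff_apply, PowerSeries.coeff_map,
        PowerSeries.coeff_mk, hg, map_one]
    let u : PowerSeries SymFun[X] := PowerSeries.X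
    let x : PowerSeries SymFun[X] := PowerSeries.C (X : SymFun[X])
    have hE : (1 - u * x) * PowerSeries.map eHom (PowerSeries.mk e) =
        PowerSeries.map C (PowerSeries.mk e) := by
      ext1 n
      cases n with
      | zero => simp [u, sub_mul, mul_assoc, h0 _ _ e_zero, e_zero]
      | succ n =>
        simp [u, x, sub_mul, mul_assoc, PowerSeries.coeff_succ_X_mul, eHom_e_succ]
    have hH : PowerSeries.map eHom (PowerSeries.mk h) =
        (1 + u * x) * PowerSeries.map C (PowerSeries.mk h) := by
      ext1 n
      cases n with
      | zero => simp [u, add_mul, mul_assoc, h0 _ _ h_zero, h_zero]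
      | succ n =>
        simp [u, x, add_mul, mul_assoc, PowerSeries.coeff_succ_X_mul, eHom_h_succ]
    have h1 : (1 - u * x) * PowerSeries.map eHom (PowerSeries.mk q) =
        (1 + u * x) * PowerSeries.map C (PowerSeries.mk q) := by
      rw [hq, map_mul, map_mul, ← mul_assoc, hE, hH]
      ring
    have h2 := congrArg (PowerSeries.coeff (n + 1)) h1
    simp only [u, x, sub_mul, add_mul, mul_assoc, one_mul, map_sub, map_add,
      PowerSeries.coeff_succ_X_mul, PowerSeries.coeff_C_mul, PowerSeries.coeff_map,
      PowerSeries.coeff_mk] at h2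
    linear_combination h2

/-- The generating functions satisfy `Ĝ(-u) G(u) = 1`. -/
def IsInverse (g' g : ℕ → SymFun) : Prop :=
  (PowerSeries.mk fun k => (-1) ^ k * g' k) * PowerSeries.mk g = 1

theorem isInverse_h_e : IsInverse h e := by
  ext n
  rw [PowerSeries.coeff_mul, PowerSeries.coeff_one, ← sum_h_e]
  simp only [PowerSeries.coeff_mk, mul_assoc]

theorem isInverse_e_h : IsInverse e h := by
  ext n
  rw [PowerSeries.coeff_mul, PowerSeries.coeff_one]
  simp only [PowerSeries.coeff_mk, mul_assoc]
  split_ifs with hn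
  · subst hn
    simp [e_zero, h_zero]
  · exact sum_e_h n hn

/-- The generating function of q is E(u)H(u), so this is the product of E(-u)H(u) = 1 and H(-u)E(u)
= 1. -/
theorem isInverse_q_q : IsInverse q q := by
  have hq : (PowerSeries.mk q) = PowerSeries.mk e * PowerSeries.mk h := by
    ext n
    rw [PowerSeries.coeff_mul, PowerSeries.coeff_mk, q]
    simp only [PowerSeries.coeff_mk]
  have hq' : (PowerSeries.mk fun k => (-1) ^ k * q k) =
      (PowerSeries.mk fun k => (-1) ^ k * e k) * PowerSeries.mk fun k => (-1) ^ k * h k := by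
    ext n
    rw [PowerSeries.coeff_mul, PowerSeries.coeff_mk, q, Finset.mul_sum]
    refine Finset.sum_congr rfl fun p hp => ?_
    simp only [PowerSeries.coeff_mk]
    rw [← Finset.HasAntidiagonal.mem_antidiagonal.1 hp, pow_add]
    ring
  have h1 : (PowerSeries.mk fun k => (-1) ^ k * e k) * PowerSeries.mk h = 1 := isInverse_e_h
  have h2 : (PowerSeries.mk fun k => (-1) ^ k * h k) * PowerSeries.mk e = 1 := isInverse_h_e
  rw [IsInverse, hq, hq']
  linear_combination PowerSeries.mk h * (PowerSeries.mk fun k => (-1) ^ k * e k) * h2 + h1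

/-! ### The entries g_{i,j} under a spreading homomorphism -/

theorem schurPair_zero_right {g : ℕ → SymFun} (hg : g 0 = 1) (i : ℕ) : schurPair g i 0 = g i := by
  simp [schurPair, hg]

theorem schurPair_eq_sum_range (g : ℕ → SymFun) (i j : ℕ) : schurPair g i j =
    2 * ∑ p ∈ Finset.range (j + 1), (-1) ^ p * (g (i + p) * g (j - p)) - g i * g j := by
  rw [schurPair, Finset.range_eq_Ico, Finset.sum_eq_sum_Ico_succ_bot (Nat.succ_pos j)]
  simp only [pow_zero, one_mul, add_zero, Nat.sub_zero, zero_add]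
  rw [show Finset.Icc 1 j = Finset.Ico 1 (j + 1) from rfl]
  ring

/-- Up to sign, the terms with p ≥ 1 are those of the pair (i+1, j). The recursion lowers j for all
i at once and needs no skew symmetry. -/
theorem schurPair_succ_right (g : ℕ → SymFun) (i j : ℕ) :
    schurPair g i (j + 1) = g i * g (j + 1) - g (i + 1) * g j - schurPair g (i + 1) j := by
  rw [schurPair_eq_sum_range, schurPair_eq_sum_range, Finset.sum_range_succ']
  have : ∀ p ∈ Finset.range (j + 1), (-1 : SymFun) ^ (p + 1) * (g (i + (p + 1)) *
      g (j + 1 - (p + 1))) = -((-1) ^ p * (g (i + 1 + p) * g (j - p))) := by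
    intro p _
    rw [Nat.succ_sub_succ, show i + (p + 1) = i + 1 + p by omega]
    ring
  rw [Finset.sum_congr rfl this, Finset.sum_neg_distrib]
  simp only [pow_zero, one_mul, add_zero, Nat.sub_zero]
  ring

/-- In the recursion on j, the products X χ(g_i) χ(g_j) coming from χ(g_i) χ(g_{j+1}) and χ(g_{i+1})
χ(g_j) cancel, which leaves only terms linear in χ. -/
theorem IsSpread.map_schurPair {χ : SymFun →+* SymFun[X]} {g : ℕ → SymFun} (hχ : IsSpread χ g)
    (i j : ℕ) : χ (schurPair g i j) =
      C (schurPair g i j) + χ (g i) * C (g j) - C (g i) * χ (g j) := by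
  induction j generalizing i with
  | zero =>
    rw [schurPair_zero_right hχ.zero, hχ.zero, map_one, map_one]
    ring
  | succ j ih =>
    rw [schurPair_succ_right, map_sub, map_sub, map_mul, map_mul, ih, map_sub, map_sub, map_mul,
      map_mul, hχ.succ, hχ.succ]
    ring

/-- This is (1+Xu)/(1-Xu) = 2/(1-Xu) - 1, read off coefficientwise. -/
theorem IsSpread.apply_eq_sum {χ : SymFun →+* SymFun[X]} {g : ℕ → SymFun} (hχ : IsSpread χ g)
    (l : ℕ) : χ (g l) =
      2 * ∑ k ∈ Finset.range (l + 1), C (g (l - k)) * X ^ k - C (g l) := by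
  induction l with
  | zero => simp [hχ.zero]; ring
  | succ l ih =>
    rw [hχ.succ, ih, Finset.sum_range_succ' _ (l + 1)]
    have : ∀ k ∈ Finset.range (l + 1), C (g (l + 1 - (k + 1))) * X ^ (k + 1) =
        X * (C (g (l - k)) * X ^ k) := by
      intro k _
      rw [Nat.succ_sub_succ]
      ring
    rw [Finset.sum_congr rfl this, ← Finset.mul_sum]
    simp only [pow_zero, mul_one, Nat.sub_zero]
    ring

/-! ### Vertex operators and their eigenvectors -/

/-- The linear map with `X^k ↦ w_k`. -/
noncomputable def pairing (w : ℕ → SymFun) : SymFun[X] →ₗ[SymFun] SymFun :=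
  Polynomial.lsum fun k => LinearMap.toSpanSingleton SymFun SymFun (w k)

theorem pairing_C_mul (w : ℕ → SymFun) (c : SymFun) (p : SymFun[X]) :
    pairing w (C c * p) = c * pairing w p := by
  rw [← Polynomial.smul_eq_C_mul, map_smul, smul_eq_mul]

theorem pairing_X_pow (w : ℕ → SymFun) (k : ℕ) : pairing w (X ^ k) = w k := by
  rw [pairing, Polynomial.lsum_apply, ← Polynomial.monomial_one_right_eq_X_pow,
    Polynomial.sum_monomial_index _ _ (by simp), LinearMap.toSpanSingleton_apply, one_smul]

theorem pairing_C (w : ℕ → SymFun) (c : SymFun) : pairing w (C c) = c * w 0 := by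
  rw [← mul_one (C c), pairing_C_mul, ← pow_zero X, pairing_X_pow]

theorem pairing_eq_sum (w : ℕ → SymFun) (p : SymFun[X]) {N : ℕ} (hN : p.natDegree < N) :
    pairing w p = ∑ k ∈ Finset.range N, w k * p.coeff k := by
  conv_lhs => rw [p.as_sum_range_C_mul_X_pow' hN]
  rw [map_sum]
  exact Finset.sum_congr rfl fun k _ => by rw [pairing_C_mul, pairing_X_pow, mul_comm]

theorem pairing_contract (w : ℕ → SymFun) (a : ℕ → SymFun[X]) (f : List ℕ → SymFun) (L : List ℕ) :
    pairing w (contract a (fun K => C (f K)) L) = contract (fun i => pairing w (a i)) f L := by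
  rw [contract_eq_sum, contract_eq_sum, map_sum]
  refine Finset.sum_congr rfl fun j _ => ?_
  have : (-1 : SymFun[X]) ^ (j : ℕ) * (a (L.get j) * C (f (L.eraseIdx j))) =
      C ((-1) ^ (j : ℕ) * f (L.eraseIdx j)) * a (L.get j) := by
    simp only [map_mul, map_pow, map_neg, map_one]
    ring
  rw [this, pairing_C_mul]
  ring

theorem IsSpread.pairing_apply {χ : SymFun →+* SymFun[X]} {g : ℕ → SymFun} (hχ : IsSpread χ g)
    (w : ℕ → SymFun) (l : ℕ) : pairing w (χ (g l)) =
      2 * ∑ k ∈ Finset.range (l + 1), g (l - k) * w k - g l * w 0 := by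
  have h2 : (2 : SymFun[X]) = C 2 := rfl
  rw [hχ.apply_eq_sum, map_sub, h2, pairing_C_mul, map_sum, pairing_C]
  simp only [pairing_C_mul, pairing_X_pow]

theorem IsSpread.pairing_map_pfaffian {χ : SymFun →+* SymFun[X]} {g : ℕ → SymFun}
    (hχ : IsSpread χ g) (w : ℕ → SymFun) (L : List ℕ) :
    pairing w (χ (pfaffian (schurPair g) L)) = pfaffian (schurPair g) L * w 0 +
      contract (fun i => pairing w (χ (g i))) (contract g (pfaffian (schurPair g))) L := by
  rw [map_pfaffian χ (schurPair g) (fun i => χ (g i)) g hχ.map_schurPair, map_add, pairing_C,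
    pairing_contract]

/-- Substituting for the powers of X in G(u)(2/(1-Xu) - 1) gives 2 G(u) G'(-u) - G(u) = 2 - G(u). -/
theorem IsSpread.pairing_inverse {χ : SymFun →+* SymFun[X]} {g g' : ℕ → SymFun}
    (hχ : IsSpread χ g) (hg : IsInverse g' g) (h0 : g' 0 = 1) (l : ℕ) :
    pairing (fun k => (-1) ^ k * g' k) (χ (g l)) = (if l = 0 then 2 else 0) - g l := by
  have h1 := congrArg (PowerSeries.coeff l) hg
  rw [PowerSeries.coeff_mul, PowerSeries.coeff_one,
    Finset.Nat.sum_antidiagonal_eq_sum_range_succ_mk] at h1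
  simp only [PowerSeries.coeff_mk] at h1
  rw [hχ.pairing_apply, h0, Finset.sum_congr rfl fun k _ => mul_comm _ _, h1]
  split_ifs <;> simp

theorem schurPfaffian_of_even (g : ℕ → SymFun) {L : List ℕ} (hL : Even L.length) :
    schurPfaffian g L = pfaffian (schurPair g) L := by
  rw [schurPfaffian, evenList, if_pos hL]

/-- The column of the padding letter is g itself, because g_{i,0} = g_i. -/
theorem schurPfaffian_of_odd {g : ℕ → SymFun} (hg : g 0 = 1) {L : List ℕ} (hL : ¬ Even L.length) :
    schurPfaffian g L = contract g (pfaffian (schurPair g)) L := by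
  rw [schurPfaffian, evenList, if_neg hL, pfaffian_append_singleton]
  congr 1
  exact funext fun i => schurPair_zero_right hg i

/-- The Pfaffians are eigenvectors of the vertex operator `∑ (-1)^k g'_k D_k`. -/
theorem IsSpread.pairing_schurPfaffian {χ : SymFun →+* SymFun[X]} {g g' : ℕ → SymFun}
    (hχ : IsSpread χ g) (hg : IsInverse g' g) (h0 : g' 0 = 1) {L : List ℕ} (hL : 0 ∉ L) :
    pairing (fun k => (-1) ^ k * g' k) (χ (schurPfaffian g L)) =
      (-1) ^ L.length * schurPfaffian g L := by
  have key : ∀ K, pairing (fun k => (-1) ^ k * g' k) (χ (pfaffian (schurPair g) K)) =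
      pfaffian (schurPair g) K + contract (fun l => if l = 0 then 2 else 0)
        (contract g (pfaffian (schurPair g))) K := by
    intro K
    rw [hχ.pairing_map_pfaffian]
    simp only [hχ.pairing_inverse hg h0, h0, pow_zero, mul_one, sub_eq_add_neg]
    rw [contract_add_left, contract_neg_left, contract_self, neg_zero, add_zero]
  have hz : ∀ f : List ℕ → SymFun, contract (fun l => if l = 0 then 2 else 0) f L = 0 := by
    intro f
    -- The zero is written as a product so that `contract_mul_left` can pull out the factor 0.
    rw [contract_congr_left (a' := fun _ => 0 * 0) f fun i hi => ?_, contract_mul_left, zero_mul]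
    rw [if_neg (ne_of_mem_of_not_mem hi hL), zero_mul]
  by_cases hE : Even L.length
  · rw [schurPfaffian_of_even g hE, key, hz, hE.neg_one_pow]
    ring
  -- Only the padding letter survives: it sits after an odd number of letters and contributes -2
  -- times the contraction by g, which is the padded Pfaffian itself.
  · rw [schurPfaffian, evenList, if_neg hE, key, contract_append_singleton, hz, if_pos rfl,
      ← schurPfaffian_of_odd hχ.zero hE, (Nat.not_even_iff_odd.1 hE).neg_one_pow, schurPfaffian,
      evenList, if_neg hE]
    ring

theorem finsum_eq_pairing {a g' : ℕ → SymFun} {f : SymFun} {p : SymFun[X]}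
    (hp : ∀ k, p.coeff k = foulkes (a k) f) (ha : a 0 = 1) (h0 : g' 0 = 1) :
    ∑ᶠ k : ℕ, (-1) ^ (k + 1) * (foulkes (a (k + 1)) f * g' (k + 1)) =
      pairing (fun k => (-1) ^ k * g' k) p - f := by
  -- The term of index 0 is split off; it equals `f`, and the remaining ones match the finite sum.
  rw [pairing_eq_sum _ p (N := p.natDegree + 1 + 1) (by omega), Finset.sum_range_succ',
    finsum_eq_sum_of_support_subset (s := Finset.range (p.natDegree + 1))]
  · rw [hp 0, ha, h0, foulkes_one, pow_zero, one_mul, one_mul, add_sub_cancel_right]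
    exact Finset.sum_congr rfl fun k _ => by rw [hp]; ring
  · intro k hk
    rw [Finset.mem_coe, Finset.mem_range]
    by_contra hlt
    apply hk
    simp only
    rw [← hp, Polynomial.coeff_eq_zero_of_natDegree_lt (by omega), zero_mul, mul_zero]

theorem half_smul_add_of_eq {f x : SymFun} {n : ℕ} (hx : x = (-1) ^ n * f) :
    f + (2 : ℚ)⁻¹ • (x - f) = if Even n then f else 0 := by
  split_ifs with hn
  · rw [hx, hn.neg_one_pow, one_mul, sub_self, smul_zero, add_zero]
  · rw [hx, (Nat.not_even_iff_odd.1 hn).neg_one_pow, neg_one_mul]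
    module

theorem finsum_half_smul {u v : ℕ → SymFun} (h : ∀ k, u k = (2 : ℚ)⁻¹ • v k) :
    ∑ᶠ k, u k = (2 : ℚ)⁻¹ • ∑ᶠ k, v k := by
  rw [smul_finsum]
  exact finsum_congr h

theorem opUs_eq (f : SymFun) :
    opUs f = f + (2 : ℚ)⁻¹ • (pairing (fun k => (-1) ^ k * h k) (qHom f) - f) := by
  rw [opUs, ← finsum_eq_pairing (a := q) (fun k => coeff_qHom f k) q_zero h_zero,
    finsum_half_smul fun k => ?_]
  rw [schurP_single, foulkes_smul_left, smul_mul_assoc, mul_smul_comm]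

theorem opUe_eq (f : SymFun) :
    opUe f = f + (2 : ℚ)⁻¹ • (pairing (fun k => (-1) ^ k * e k) (qHom f) - f) := by
  rw [opUe, ← finsum_eq_pairing (a := q) (fun k => coeff_qHom f k) q_zero e_zero,
    finsum_half_smul fun k => ?_]
  rw [schurP_single, foulkes_smul_left, smul_mul_assoc, mul_smul_comm]

theorem opVe_eq (f : SymFun) :
    opVe f = f + (2 : ℚ)⁻¹ • (pairing (fun k => (-1) ^ k * q k) (eHom f) - f) := by
  rw [opVe, ← finsum_eq_pairing (a := e) (fun k => coeff_eHom f k) e_zero q_zero,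
    finsum_half_smul fun k => ?_]
  rw [schurP_single, mul_smul_comm, mul_smul_comm]

theorem opUs_qTilde {L : List ℕ} (hL : 0 ∉ L) :
    opUs (qTilde L) = if Even L.length then qTilde L else 0 := by
  rw [opUs_eq]
  exact half_smul_add_of_eq (isSpread_qHom_e.pairing_schurPfaffian isInverse_h_e h_zero hL)

theorem opUe_schurPfaffian {L : List ℕ} (hL : 0 ∉ L) :
    opUe (schurPfaffian h L) = if Even L.length then schurPfaffian h L else 0 := by
  rw [opUe_eq]
  exact half_smul_add_of_eq (isSpread_qHom_h.pairing_schurPfaffian isInverse_e_h e_zero hL)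

theorem opVe_schurP {L : List ℕ} (hL : 0 ∉ L) :
    opVe (schurP L) = if Even L.length then schurP L else 0 := by
  rw [opVe_eq]
  refine half_smul_add_of_eq ?_
  have h1 : ∀ (c : ℚ) (f : SymFun), c • f = algebraMap ℚ SymFun c * f := fun c f =>
    Algebra.smul_def c f
  have h2 := isSpread_eHom_q.pairing_schurPfaffian isInverse_q_q q_zero hL
  have h3 : ∀ c : ℚ, eHom (algebraMap ℚ SymFun c) = C (algebraMap ℚ SymFun c) := fun c =>
    DFunLike.congr_fun (Subsingleton.elim (eHom.comp (algebraMap ℚ SymFun))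
      (C.comp (algebraMap ℚ SymFun))) c
  rw [schurP, schurQ, h1, map_mul, h3, pairing_C_mul, h2]
  ring

/-- Adding a row to a Pfaffian is the action of a vertex operator. -/
theorem IsSpread.schurPfaffian_cons {χ : SymFun →+* SymFun[X]} {g : ℕ → SymFun}
    (hχ : IsSpread χ g) (i : ℕ) (L : List ℕ) : schurPfaffian g (i :: L) =
      pairing (fun k => (-1) ^ k * g (i + k)) (χ (schurPfaffian g L)) := by
  have hM : ∀ l, pairing (fun k => (-1) ^ k * g (i + k)) (χ (g l)) = schurPair g i l := by
    intro l
    rw [hχ.pairing_apply, schurPair_eq_sum_range]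
    have : ∀ k ∈ Finset.range (l + 1), g (l - k) * ((-1) ^ k * g (i + k)) =
        (-1) ^ k * (g (i + k) * g (l - k)) := fun k _ => by ring
    rw [Finset.sum_congr rfl this]
    simp only [pow_zero, one_mul, add_zero]
    ring
  have key : ∀ K, pairing (fun k => (-1) ^ k * g (i + k)) (χ (pfaffian (schurPair g) K)) =
      pfaffian (schurPair g) K * g i +
        contract (schurPair g i) (contract g (pfaffian (schurPair g))) K := by
    intro K
    rw [hχ.pairing_map_pfaffian]
    simp only [hM, pow_zero, one_mul, add_zero]
  by_cases hE : Even L.length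
  · rw [schurPfaffian_of_even g hE, key, schurPfaffian_of_odd hχ.zero (by
      rw [List.length_cons, Nat.even_add_one]; exact not_not.2 hE), contract_cons]
    simp only [pfaffian_cons]
    rw [contract_comm g]
    ring
  -- Contraction by g of a padded list undoes the padding: the other terms form a double contraction
  -- by g, and g_0 = 1.
  · have h1 : ∀ K, contract g (pfaffian (schurPair g)) (K ++ [0]) = pfaffian (schurPair g) K := by
      intro K
      rw [contract_append_singleton]
      simp only [pfaffian_append_singleton, schurPair_zero_right hχ.zero]
      rw [contract_self, hχ.zero, zero_add, one_mul]
      rcases Nat.even_or_odd K.length with h | h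
      · rw [h.neg_one_pow, one_mul]
      · rw [pfaffian_eq_zero _ h, mul_zero]
    rw [schurPfaffian_of_even g (by rw [List.length_cons, Nat.even_add_one]; exact hE),
      schurPfaffian, evenList, if_neg hE, key, contract_append_singleton]
    simp only [h1]
    rw [pfaffian_append_singleton, (Nat.not_even_iff_odd.1 hE).neg_one_pow,
      schurPair_zero_right hχ.zero, pfaffian_cons]
    simp only [schurPair_zero_right hχ.zero]
    ring

/-! ### The raising operator formula at t = -1 -/

theorem schurPfaffian_nil (g : ℕ → SymFun) : schurPfaffian g [] = 1 := by
  rw [schurPfaffian_of_even g (by simp), pfaffian_nil]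

/-- The pairs `i < j` that index the raising operators. -/
abbrev RaisingPair (n : ℕ) : Type := {p : Fin n × Fin n // p.1 < p.2}

/-- The index vector `v` after the raising operators with the exponents `m` have acted. -/
def raisedIndex {n : ℕ} (v : Fin n → ℕ) (m : RaisingPair n → ℕ) (i : Fin n) : ℤ :=
  (v i : ℤ) + (∑ p, if p.1.1 = i then (m p : ℤ) else 0) - ∑ p, if p.1.2 = i then (m p : ℤ) else 0

/-- The term of the raising operator expansion with the exponents `m`. -/
noncomputable def raisingTerm {n : ℕ} (t : ℚ) (v : Fin n → ℕ) (m : RaisingPair n → ℕ) : SymFun :=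
  (∏ p, raisingCoeff t (m p)) • ∏ i, hInt (raisedIndex v m i)

/-- The raising operator expansion, truncated to the exponents that are at most `N`. -/
noncomputable def raisingSum {n : ℕ} (t : ℚ) (N : ℕ) (v : Fin n → ℕ) : SymFun :=
  ∑ m ∈ Fintype.piFinset fun _ : RaisingPair n => Finset.range (N + 1), raisingTerm t v m

theorem hInt_of_neg {z : ℤ} (hz : z < 0) : hInt z = 0 := if_neg (not_le.2 hz)

theorem hInt_natCast (n : ℕ) : hInt n = h n := if_pos (Int.natCast_nonneg n)

theorem sum_raisedIndex {n : ℕ} (v : Fin n → ℕ) (m : RaisingPair n → ℕ) (s : Finset (Fin n)) :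
    ∑ i ∈ s, raisedIndex v m i = ∑ i ∈ s, (v i : ℤ) +
      ∑ p, (m p : ℤ) * ((if p.1.1 ∈ s then 1 else 0) - if p.1.2 ∈ s then 1 else 0) := by
  simp only [raisedIndex, Finset.sum_sub_distrib, Finset.sum_add_distrib, mul_sub]
  rw [Finset.sum_comm, Finset.sum_comm (s := s) (t := Finset.univ)]
  simp [add_sub_assoc]

/-- Raising operators preserve the total of the indices, so a nonnegative index vector is bounded by
that total. -/
theorem raisedIndex_le {n : ℕ} {v : Fin n → ℕ} {m : RaisingPair n → ℕ}
    (hm : ∀ i, 0 ≤ raisedIndex v m i) (i : Fin n) : raisedIndex v m i ≤ ((∑ j, v j : ℕ) : ℤ) := by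
  have h1 := sum_raisedIndex v m Finset.univ
  simp only [Finset.mem_univ, if_true, sub_self, mul_zero, Finset.sum_const_zero, add_zero] at h1
  push_cast
  rw [← h1]
  exact Finset.single_le_sum (fun j _ => hm j) (Finset.mem_univ i)

/-- Consider the sum of the indices from position `r.1.2` on. No R_{ij} increases it, and the
operator of `r` lowers it by `m r`; as it remains nonnegative, `m r` is at most its initial value.
-/
theorem exponent_le {n : ℕ} {v : Fin n → ℕ} {m : RaisingPair n → ℕ}
    (hm : ∀ i, 0 ≤ raisedIndex v m i) (r : RaisingPair n) : m r ≤ ∑ j, v j := by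
  have h1 := sum_raisedIndex v m (Finset.Ici r.1.2)
  have h2 : 0 ≤ ∑ i ∈ Finset.Ici r.1.2, raisedIndex v m i := Finset.sum_nonneg fun i _ => hm i
  have h3 : ∑ i ∈ Finset.Ici r.1.2, (v i : ℤ) ≤ ((∑ j, v j : ℕ) : ℤ) := by
    push_cast
    exact Finset.sum_le_sum_of_subset_of_nonneg (Finset.subset_univ _) fun _ _ _ =>
      Int.natCast_nonneg _
  have h4 : ∀ p : RaisingPair n, (m p : ℤ) * ((if p.1.1 ∈ Finset.Ici r.1.2 then 1 else 0) -
      if p.1.2 ∈ Finset.Ici r.1.2 then 1 else 0) ≤ 0 := by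
    intro p
    refine mul_nonpos_of_nonneg_of_nonpos (Int.natCast_nonneg _) ?_
    simp only [Finset.mem_Ici]
    have := p.2
    split_ifs with h5 h6 <;> simp
    exact h6 (h5.trans this.le)
  have h5 := Finset.sum_nonpos fun p (_ : p ∈ Finset.univ.erase r) => h4 p
  rw [← Finset.add_sum_erase _ _ (Finset.mem_univ r)] at h1
  simp only [Finset.mem_Ici, le_refl, if_true, not_le.2 r.2, if_false] at h1 h5
  zify
  push_cast at h3
  linarith

theorem raisingTerm_eq_zero {n : ℕ} (t : ℚ) {v : Fin n → ℕ} {m : RaisingPair n → ℕ}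
    (hm : ¬ ∀ i, 0 ≤ raisedIndex v m i) : raisingTerm t v m = 0 := by
  obtain ⟨i, hi⟩ := not_forall.1 hm
  rw [raisingTerm, Finset.prod_eq_zero (Finset.mem_univ i) (hInt_of_neg (not_le.1 hi)), smul_zero]

/-- Larger exponents produce a negative index, so the truncation bound is immaterial once it reaches
the total. The recursion needs this, since prepending a part changes the bound. -/
theorem raisingSum_eq {n : ℕ} (t : ℚ) {N : ℕ} {v : Fin n → ℕ} (hN : ∑ j, v j ≤ N) :
    raisingSum t N v = raisingSum t (∑ j, v j) v := by
  refine (Finset.sum_subset (fun m hm => ?_) fun m _ hm =>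
    raisingTerm_eq_zero t fun h0 => hm ?_).symm
  · simp only [Fintype.mem_piFinset, Finset.mem_range] at hm ⊢
    exact fun p => (hm p).trans_le (by omega)
  · simp only [Fintype.mem_piFinset, Finset.mem_range]
    exact fun p => Nat.lt_succ_of_le (exponent_le h0 p)

theorem hallLittlewoodQPrime_eq (t : ℚ) (L : List ℕ) :
    hallLittlewoodQPrime t L = raisingSum t L.sum L.get := by
  refine Finset.sum_bij (fun m _ p => (m p : ℕ)) ?_ ?_ ?_ ?_
  · intro m _
    simp only [Fintype.mem_piFinset, Finset.mem_range]
    exact fun p => (m p).2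
  · intro m _ m' _ hmm
    exact funext fun p => Fin.ext (congrFun hmm p)
  · intro m hm
    simp only [Fintype.mem_piFinset, Finset.mem_range] at hm
    exact ⟨fun p => ⟨m p, hm p⟩, Finset.mem_univ _, rfl⟩
  · intro m _
    rfl

/-- The pairs `i < j` in `Fin (n + 1)`: those with `i = 0`, and those in the last `n` places. -/
noncomputable def raisingPairEquiv (n : ℕ) : Fin n ⊕ RaisingPair n ≃ RaisingPair (n + 1) :=
  Equiv.ofBijective
    (Sum.elim (fun j => ⟨(0, j.succ), j.succ_pos⟩)
      fun p => ⟨(p.1.1.succ, p.1.2.succ), Fin.succ_lt_succ_iff.2 p.2⟩) (by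
    constructor
    · rintro (j | ⟨⟨a, b⟩, hab⟩) (j' | ⟨⟨a', b'⟩, hab'⟩) hj
      · simpa using hj
      · simp [Fin.ext_iff] at hj
      · simp [Fin.ext_iff] at hj
      · simpa using hj
    · rintro ⟨⟨a, b⟩, hab⟩
      cases b using Fin.cases with
      | zero => exact absurd hab (Fin.not_lt_zero _)
      | succ b =>
        cases a using Fin.cases with
        | zero => exact ⟨Sum.inl b, rfl⟩
        | succ a => exact ⟨Sum.inr ⟨(a, b), Fin.succ_lt_succ_iff.1 hab⟩, rfl⟩)

theorem raisingPairEquiv_inl {n : ℕ} (j : Fin n) :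
    raisingPairEquiv n (Sum.inl j) = ⟨(0, j.succ), j.succ_pos⟩ := rfl

theorem raisingPairEquiv_inr {n : ℕ} (p : RaisingPair n) : raisingPairEquiv n (Sum.inr p) =
    ⟨(p.1.1.succ, p.1.2.succ), Fin.succ_lt_succ_iff.2 p.2⟩ := rfl

theorem raisedIndex_cons_zero {n : ℕ} (a : ℕ) (v : Fin n → ℕ) (k : Fin n → ℕ)
    (m : RaisingPair n → ℕ) :
    raisedIndex (Fin.cons a v : Fin (n + 1) → ℕ) (Sum.elim k m ∘ (raisingPairEquiv n).symm) 0 =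
      ((a + ∑ j, k j : ℕ) : ℤ) := by
  rw [raisedIndex, ← (raisingPairEquiv n).sum_comp, ← (raisingPairEquiv n).sum_comp,
    Fintype.sum_sum_type, Fintype.sum_sum_type]
  simp only [Function.comp_apply, Equiv.symm_apply_apply, Sum.elim_inl, Sum.elim_inr]
  simp [raisingPairEquiv_inl, raisingPairEquiv_inr]

theorem raisedIndex_cons_succ {n : ℕ} (a : ℕ) (v : Fin n → ℕ) (k : Fin n → ℕ)
    (m : RaisingPair n → ℕ) (i : Fin n) :
    raisedIndex (Fin.cons a v : Fin (n + 1) → ℕ) (Sum.elim k m ∘ (raisingPairEquiv n).symm)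
      i.succ = raisedIndex v m i - k i := by
  rw [raisedIndex, ← (raisingPairEquiv n).sum_comp, ← (raisingPairEquiv n).sum_comp,
    Fintype.sum_sum_type, Fintype.sum_sum_type]
  simp only [Function.comp_apply, Equiv.symm_apply_apply, Sum.elim_inl, Sum.elim_inr]
  simp [raisingPairEquiv_inl, raisingPairEquiv_inr, raisedIndex,
    (Fin.succ_ne_zero _).symm]
  ring

/-- The exponents split into those of the operators that involve the new first position (`k`) and
the others (`m`). The former raise `a` by their sum, and each lowers its own later index. -/
theorem raisingSum_cons {n : ℕ} (t : ℚ) (N a : ℕ) (v : Fin n → ℕ) :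
    raisingSum t N (Fin.cons a v : Fin (n + 1) → ℕ) =
      ∑ m ∈ Fintype.piFinset fun _ : RaisingPair n => Finset.range (N + 1),
        (∏ p, raisingCoeff t (m p)) • ∑ k ∈ Fintype.piFinset fun _ : Fin n => Finset.range (N + 1),
          (∏ j, raisingCoeff t (k j)) •
            (h (a + ∑ j, k j) * ∏ j, hInt (raisedIndex v m j - k j)) := by
  simp only [Finset.smul_sum]
  rw [← Finset.sum_product', raisingSum]
  symm
  refine Finset.sum_bij' (fun x _ => Sum.elim x.2 x.1 ∘ (raisingPairEquiv n).symm)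
    (fun m _ => (fun p => m (raisingPairEquiv n (Sum.inr p)),
      fun j => m (raisingPairEquiv n (Sum.inl j)))) ?_ ?_ ?_ ?_ ?_
  · rintro ⟨m, k⟩ hx
    simp only [Finset.mem_product, Fintype.mem_piFinset] at hx ⊢
    intro p
    obtain ⟨y, rfl⟩ := (raisingPairEquiv n).surjective p
    rw [Function.comp_apply, Equiv.symm_apply_apply]
    cases y with
    | inl j => exact hx.2 j
    | inr p => exact hx.1 p
  · intro m hm
    simp only [Finset.mem_product, Fintype.mem_piFinset] at hm ⊢
    exact ⟨fun p => hm _, fun j => hm _⟩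
  · rintro ⟨m, k⟩ _
    simp
  · intro m _
    funext p
    obtain ⟨y, rfl⟩ := (raisingPairEquiv n).surjective p
    rw [Function.comp_apply, Equiv.symm_apply_apply]
    cases y <;> rfl
  · rintro ⟨m, k⟩ _
    rw [raisingTerm, ← (raisingPairEquiv n).prod_comp, Fintype.prod_sum_type, Fin.prod_univ_succ,
      raisedIndex_cons_zero, hInt_natCast, smul_smul, mul_comm]
    simp only [raisedIndex_cons_succ, Function.comp_apply, Equiv.symm_apply_apply, Sum.elim_inl,
      Sum.elim_inr]

/-- The coefficients 1, 2, 2, … of (1+Xu)/(1-Xu) are, up to the signs (-1)^k, those of (1-R)/(1+R).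
-/
theorem qHom_hInt {z : ℤ} {N : ℕ} (hz : z ≤ N) : qHom (hInt z) = ∑ k ∈ Finset.range (N + 1),
    C ((-1) ^ k * (raisingCoeff (-1) k • hInt (z - k))) * X ^ k := by
  rcases lt_or_ge z 0 with h0 | h0
  · rw [hInt_of_neg h0, map_zero]
    refine (Finset.sum_eq_zero fun k _ => ?_).symm
    rw [hInt_of_neg (by omega), smul_zero, mul_zero, map_zero, zero_mul]
  · lift z to ℕ using h0
    rw [hInt_natCast, isSpread_qHom_h.apply_eq_sum]
    have h1 : ∑ k ∈ Finset.range (z + 1), C (h (z - k)) * X ^ k =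
        ∑ k ∈ Finset.range (N + 1), C (hInt (z - k)) * X ^ k := by
      rw [← Finset.sum_subset (Finset.range_subset_range.2 (show z + 1 ≤ N + 1 by omega))]
      · refine Finset.sum_congr rfl fun k hk => ?_
        rw [Finset.mem_range] at hk
        rw [← hInt_natCast, Nat.cast_sub (by omega)]
      · intro k _ hk
        rw [Finset.mem_range] at hk
        rw [hInt_of_neg (by omega), map_zero, zero_mul]
    have h2 : ∀ k, C ((-1) ^ (k + 1) * (raisingCoeff (-1) (k + 1) • hInt (z - (k + 1 : ℕ)))) *
        X ^ (k + 1) = 2 * (C (hInt (z - (k + 1 : ℕ))) * X ^ (k + 1)) := by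
      intro k
      have h3 : (-1 : ℚ) ^ (k + 1) * raisingCoeff (-1) (k + 1) = 2 := by
        rw [raisingCoeff]
        linear_combination 2 * neg_one_pow_mul_self (R := ℚ) k
      rw [neg_one_pow_eq_smul, smul_smul, h3, ← mul_assoc]
      congr 1
      rw [two_smul, map_add, two_mul]
    rw [h1, Finset.sum_range_succ', Finset.sum_range_succ', Finset.sum_congr rfl fun k _ => h2 k,
      ← Finset.mul_sum]
    simp only [raisingCoeff, Nat.cast_zero, sub_zero, hInt_natCast, pow_zero, one_smul, mul_one,
      one_mul]
    ring

/-- Since `qHom` is multiplicative, each factor contributes its own exponent k_j. The power of X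
with exponent Σ k_j becomes ± h_{a+Σ k_j}, and its sign cancels the product of the signs in
`qHom_hInt`. -/
theorem pairing_qHom_prod_hInt {n N : ℕ} (a : ℕ) {z : Fin n → ℤ} (hz : ∀ j, z j ≤ N) :
    pairing (fun k => (-1) ^ k * h (a + k)) (qHom (∏ j, hInt (z j))) =
      ∑ k ∈ Fintype.piFinset fun _ : Fin n => Finset.range (N + 1),
        (∏ j, raisingCoeff (-1) (k j)) • (h (a + ∑ j, k j) * ∏ j, hInt (z j - k j)) := by
  rw [map_prod, Finset.prod_congr rfl fun j _ => qHom_hInt (hz j), Finset.prod_univ_sum, map_sum]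
  refine Finset.sum_congr rfl fun k _ => ?_
  rw [Finset.prod_mul_distrib, ← map_prod, Finset.prod_pow_eq_pow_sum, pairing_C_mul,
    pairing_X_pow, Finset.prod_mul_distrib, Finset.prod_pow_eq_pow_sum, Finset.prod_smul]
  rw [mul_smul_comm, smul_mul_assoc]
  congr 1
  linear_combination (h (a + ∑ j, k j) * ∏ j, hInt (z j - k j)) *
    neg_one_pow_mul_self (R := SymFun) (∑ j, k j)

theorem raisingSum_cons_eq_pairing {n N : ℕ} (a : ℕ) {v : Fin n → ℕ} (hN : ∑ j, v j ≤ N) :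
    raisingSum (-1) N (Fin.cons a v : Fin (n + 1) → ℕ) =
      pairing (fun k => (-1) ^ k * h (a + k)) (qHom (raisingSum (-1) N v)) := by
  rw [raisingSum_cons, raisingSum, map_sum, map_sum]
  refine Finset.sum_congr rfl fun m _ => ?_
  rw [raisingTerm, map_rat_smul, map_rat_smul]
  congr 1
  by_cases hm : ∀ i, 0 ≤ raisedIndex v m i
  · exact (pairing_qHom_prod_hInt a fun j =>
      (raisedIndex_le hm j).trans (Int.ofNat_le.2 hN)).symm
  -- A negative index stays negative after k_i is subtracted, so both sides vanish.
  · obtain ⟨i, hi⟩ := not_forall.1 hm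
    rw [not_le] at hi
    rw [Finset.prod_eq_zero (f := fun j => hInt (raisedIndex v m j)) (Finset.mem_univ i)
      (hInt_of_neg hi), map_zero, map_zero]
    refine Finset.sum_eq_zero fun k _ => ?_
    rw [Finset.prod_eq_zero (f := fun j => hInt (raisedIndex v m j - k j)) (Finset.mem_univ i)
      (hInt_of_neg (by omega)), mul_zero, smul_zero]

/-- At `t = -1` the raising operator formula is Schur's Pfaffian. -/
theorem qPrime_eq_schurPfaffian (L : List ℕ) : qPrime L = schurPfaffian h L := by
  induction L with
  | nil =>
    have : IsEmpty (Fin ([] : List ℕ).length) := ⟨fun i => i.elim0⟩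
    rw [qPrime, hallLittlewoodQPrime_eq, schurPfaffian_nil, raisingSum, List.sum_nil,
      Finset.sum_eq_single (fun _ => 0)]
    · rw [raisingTerm, Fintype.prod_empty, Fintype.prod_empty, one_smul]
    · exact fun m _ hm => absurd (Subsingleton.elim _ _) hm
    · exact fun h0 => absurd (Fintype.mem_piFinset.2 fun _ => Finset.mem_range.2 one_pos) h0
  | cons a L ih =>
    have hs : ∑ j, L.get j = L.sum := by
      rw [← List.sum_ofFn, List.ofFn_get]
    have hc : (a :: L).get = (Fin.cons a L.get : Fin (L.length + 1) → ℕ) :=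
      funext fun i => by cases i using Fin.cases <;> rfl
    rw [isSpread_qHom_h.schurPfaffian_cons, ← ih, qPrime, qPrime, hallLittlewoodQPrime_eq,
      hallLittlewoodQPrime_eq, hc]
    have hN : ∑ j, L.get j ≤ (a :: L).sum := by rw [hs, List.sum_cons]; omega
    refine (raisingSum_cons_eq_pairing a hN).trans ?_
    -- The expansion of the tail is still truncated at the sum of `a :: L`; this lowers the bound to
    -- `L.sum`.
    rw [raisingSum_eq (-1) hN, hs]

theorem opUe_qPrime {L : List ℕ} (hL : 0 ∉ L) :
    opUe (qPrime L) = if Even L.length then qPrime L else 0 := by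
  rw [qPrime_eq_schurPfaffian, opUe_schurPfaffian hL]

end SymFun

theorem proposition25 {n : ℕ} (I : n.Partition) (hI : I.parts.Nodup) :
    (SymFun.opUs (SymFun.qTilde (SymFun.partList I)) =
      if Even I.parts.card then SymFun.qTilde (SymFun.partList I) else 0) ∧
    (SymFun.opUe (SymFun.qPrime (SymFun.partList I)) =
      if Even I.parts.card then SymFun.qPrime (SymFun.partList I) else 0) ∧
    (SymFun.opVe (SymFun.schurP (SymFun.partList I)) =
      if Even I.parts.card then SymFun.schurP (SymFun.partList I) else 0) := by
  have h0 : 0 ∉ SymFun.partList I := fun hm =>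
    (I.parts_pos ((Multiset.mem_sort _).1 hm)).ne' rfl
  rw [← Multiset.length_sort (s := I.parts) (r := (· ≥ ·))]
  exact ⟨SymFun.opUs_qTilde h0, SymFun.opUe_qPrime h0, SymFun.opVe_schurP h0⟩
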